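/- Let $\mathbb{F}_q$ be the finite field with $q$ elements. The height of a polynomial $P\in\mathbb{F}_q[T][X]$ is its degree in $T$, i.e. the maximal degree in $T$ of its coefficients. If $K$ is a finite extension of $\mathbb{F}_q(T)$, the height of $\alpha\in K$ is the height of its minimal polynomial over $\mathbb{F}_q[T]$, i.e. of the irreducible polynomial in $\mathbb{F}_q[T][X]$ vanishing at $\alpha$, which is unique up to a factor in $\mathbb{F}_q^*$. For $A,B\subset K$ write $AB=\{ab : a\in A,\ b\in B\}$ and, for an integer $\nu\ge 1$, $A^{(\nu)}=\{a_1\cdots a_\nu : a_1,\dots,a_\nu\in A\}$. (i) For all $q,d$ there is a constant $C=C(q,d)>0$ such that for every extension $K$ of $\mathbb{F}_q(T)$ of degree $d$, every real $h>1$, and all finite sets $A,B\subset K$ of elements of height at most $h$, each of which contains a nonzero element, $$\#(AB)>\exp\left(-C\,\frac{h}{\sqrt{\log h}}\right)\#A\,\#B.$$ (ii) For all $q,d$ and every integer $\nu\ge 1$ there is a constant $C=C(q,d,\nu)>0$ such that for every extension $K$ of $\mathbb{F}_q(T)$ of degree $d$, every real $h>1$, and every nonempty finite set $A\subset K$ of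 elements of height at most $h$, $$\#A^{(\nu)}>\exp\left(-C\,\frac{h}{\sqrt{\log h}}\right)(\#A)^{\nu}.$$ -/

import Mathlib

open scoped Pointwise

universe u v

namespace FunctionFieldHeight

open Polynomial

variable {F : Type*} [Field F] {K : Type*} [Field K] [Algebra (RatFunc F) K]

/-- The height of `P ∈ F[T][X]`: its degree in `T`, i.e. the largest degree in `T`
of a coefficient of `P`. -/
noncomputable def polyHeight (P : F[X][X]) : ℕ :=
  P.support.sup fun i => (P.coeff i).natDegree

/-- `P` is a minimal polynomial of `α` over `F[T]`: an irreducible element of `F[T][X]`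
(so in particular without a nonconstant factor in `F[T]`) that vanishes at `α`. -/
def IsMinpoly (α : K) (P : F[X][X]) : Prop :=
  Irreducible P ∧ aeval α (P.map (algebraMap F[X] (RatFunc F))) = 0

theorem IsMinpoly.associated {α : K} {P Q : F[X][X]} (hP : IsMinpoly α P)
    (hQ : IsMinpoly α Q) : Associated P Q := by
  have hinj : Function.Injective (algebraMap F[X] (RatFunc F)) :=
    IsFractionRing.injective _ _
  have key : ∀ {R : F[X][X]}, IsMinpoly α R → R.IsPrimitive ∧
      Associated (R.map (algebraMap F[X] (RatFunc F))) (minpoly (RatFunc F) α) := by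
    intro R hR
    have hne : R.map (algebraMap F[X] (RatFunc F)) ≠ 0 :=
      (Polynomial.map_ne_zero_iff hinj).2 hR.1.ne_zero
    have hint : IsIntegral (RatFunc F) α :=
      (isAlgebraic_iff_isIntegral).1 ⟨_, hne, hR.2⟩
    have hdeg : R.natDegree ≠ 0 := by
      intro h0
      obtain ⟨c, rfl⟩ := Polynomial.natDegree_eq_zero.1 h0
      have h1 := hR.2
      have h2 := hR.1.ne_zero
      simp_all
    have hprim : R.IsPrimitive := hR.1.isPrimitive hdeg
    obtain ⟨_⟩ : Nonempty (NormalizedGCDMonoid F[X]) := inferInstance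
    have hirr := (hprim.irreducible_iff_irreducible_map_fraction_map (K := RatFunc F)).1 hR.1
    exact ⟨hprim, ((minpoly.irreducible hint).associated_of_dvd hirr
      (minpoly.dvd _ _ hR.2)).symm⟩
  obtain ⟨_⟩ : Nonempty (NormalizedGCDMonoid F[X]) := inferInstance
  exact hP.1.associated_of_dvd hQ.1 <|
    Polynomial.IsPrimitive.dvd_of_fraction_map_dvd_fraction_map (K := RatFunc F)
      (key hP).1 (((key hP).2.trans (key hQ).2.symm).dvd)

theorem polyHeight_eq_of_associated {P Q : F[X][X]} (h : Associated P Q) :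
    polyHeight P = polyHeight Q := by
  obtain ⟨u, rfl⟩ := h
  obtain ⟨r, hr, hu⟩ := Polynomial.isUnit_iff.1 u.isUnit
  obtain ⟨c, hc, rfl⟩ := Polynomial.isUnit_iff.1 hr
  have hc0 : c ≠ 0 := hc.ne_zero
  have h1 : ∀ i, (P * (u : F[X][X])).coeff i = P.coeff i * C c := by
    intro i; rw [← hu, Polynomial.coeff_mul_C]
  unfold polyHeight
  have h2 : (P * (u : F[X][X])).support = P.support := by
    ext i; simp [h1, hc0]
  rw [h2]
  refine Finset.sup_congr rfl fun i _ => ?_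
  rw [h1, Polynomial.natDegree_mul_C hc0]

theorem exists_isMinpoly [FiniteDimensional (RatFunc F) K] (α : K) :
    ∃ P : F[X][X], IsMinpoly α P := by
  obtain ⟨p, hp0, hp⟩ : IsAlgebraic (RatFunc F) α := Algebra.IsAlgebraic.isAlgebraic α
  set N := IsLocalization.integerNormalization (nonZeroDivisors F[X]) p with hN
  have hN0 : N ≠ 0 := fun h => hp0 (IsFractionRing.integerNormalization_eq_zero_iff.1 h)
  let φ : F[X][X] →+* K := eval₂RingHom
    ((algebraMap (RatFunc F) K).comp (algebraMap F[X] (RatFunc F))) α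
  have hφ : ∀ P : F[X][X], φ P = aeval α (P.map (algebraMap F[X] (RatFunc F))) := by
    intro P
    rw [Polynomial.aeval_def, Polynomial.eval₂_map]
    rfl
  have hNφ : φ N = 0 :=
    IsLocalization.integerNormalization_eval₂_eq_zero (nonZeroDivisors F[X]) _ p hp
  obtain ⟨s, hs, hsN⟩ := WfDvdMonoid.exists_factors N hN0
  have hprod : (s.map φ).prod = 0 := by
    obtain ⟨w, hw⟩ := hsN
    rw [← hw, map_mul] at hNφ
    have hwu : φ (w : F[X][X]) ≠ 0 := (w.isUnit.map φ).ne_zero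
    rw [← map_multiset_prod]
    exact (mul_eq_zero.1 hNφ).resolve_right hwu
  obtain ⟨P, hPs, hP0⟩ := Multiset.mem_map.1 (Multiset.prod_eq_zero_iff.1 hprod)
  exact ⟨P, hs P hPs, (hφ P).symm.trans hP0⟩

variable (F) in
/-- The height of an element `α` of a finite extension `K` of `F(T)`: the height of its
minimal polynomial over `F[T]`. -/
noncomputable def height [FiniteDimensional (RatFunc F) K] (α : K) : ℕ :=
  polyHeight (exists_isMinpoly (F := F) α).choose

theorem height_eq [FiniteDimensional (RatFunc F) K] {α : K} {P : F[X][X]}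
    (hP : IsMinpoly α P) : height F α = polyHeight P :=
  polyHeight_eq_of_associated ((exists_isMinpoly (F := F) α).choose_spec.associated hP)

end FunctionFieldHeight

/-!
The places of `K` above `F[X]` and above `F[X⁻¹]` give a homomorphism from `Kˣ` to a power of `ℤ`
whose kernel consists of the boundedly many constants of `K`. In a power of `ℤ` product sets are
large: the weight `(2 * |t| + 1)⁻²` on `ℤ` satisfies a discrete Prékopa–Leindler inequality, which
tensorizes, so that `#U * #V ≤ E ^ 4 * #(U + V)` as soon as `∏ i, (2 * |x i| + 1) ≤ E` on `U ∪ V`.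
For an element of height at most `h` this product is small, because there are few places of small
degree, and at most `O(h / m)` places of degree greater than `m` at which the element is not a unit.
Choosing `q ^ m` of size about `√h` gives the exponent `h / log h`.

If `K` is inseparable over `F(X)`, a power map sends it into the separable closure of `F(X)`, and
the valuations are pulled back along it.
-/

namespace ProductSet

open Finset

/-- A weight satisfying a discrete Prékopa–Leindler inequality, with the pointwise product of two
functions dominated along the product set of their domains. Unlike a bound for the cardinality of
product sets, this functional form passes to finite products of groups. -/
def IsPrekopaLeindlerWeight {Γ : Type*} [Mul Γ] [DecidableEq Γ] (w : Γ → ℝ) : Prop :=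
  (∀ t, 0 ≤ w t) ∧ ∀ (S T : Finset Γ) (f g m : Γ → ℝ), (∀ a, 0 ≤ f a) → (∀ b, 0 ≤ g b) →
    (∀ a ∈ S, ∀ b ∈ T, f a * g b ≤ m (a * b)) →
    (∑ a ∈ S, f a * w a) * (∑ b ∈ T, g b * w b) ≤ ∑ t ∈ S * T, m t

section Criterion

variable {Γ : Type*} {S T : Finset Γ} {f g m : Γ → ℝ}

theorem sum_mul_weight_le [One Γ] {w : Γ → ℝ} {c F : ℝ} (hw1 : w 1 ≤ 1) (hc : ∀ t ≠ 1, w t ≤ c)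
    (hc1 : c ≤ 1) (hf : ∀ a, 0 ≤ f a) (hfF : ∀ a ∈ S, f a ≤ F) (hF : 0 ≤ F) :
    ∑ a ∈ S, f a * w a ≤ (1 - c) * F + c * ∑ a ∈ S, f a := by
  classical
  have hterm (a : Γ) (ha : a ∈ S) : f a * w a ≤ (if a = 1 then (1 - c) * F else 0) + c * f a := by
    split_ifs with h
    · subst h
      nlinarith [mul_le_mul_of_nonneg_left hw1 (hf 1),
        mul_le_mul_of_nonneg_left (hfF 1 ha) (sub_nonneg.2 hc1)]
    · nlinarith [mul_le_mul_of_nonneg_left (hc a h) (hf a)]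
  calc ∑ a ∈ S, f a * w a
      ≤ ∑ a ∈ S, ((if a = 1 then (1 - c) * F else 0) + c * f a) := sum_le_sum hterm
    _ = (if 1 ∈ S then (1 - c) * F else 0) + c * ∑ a ∈ S, f a := by
        rw [sum_add_distrib, sum_ite_eq', mul_sum]
    _ ≤ (1 - c) * F + c * ∑ a ∈ S, f a := by
        gcongr
        split_ifs
        exacts [le_rfl, mul_nonneg (sub_nonneg.2 hc1) hF]

variable [DecidableEq Γ]

theorem nonneg_of_mul_le_of_mem_mul [Mul Γ] (hf : ∀ a, 0 ≤ f a) (hg : ∀ b, 0 ≤ g b)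
    (hm : ∀ a ∈ S, ∀ b ∈ T, f a * g b ≤ m (a * b)) : ∀ t ∈ S * T, 0 ≤ m t := by
  intro t ht
  obtain ⟨a, ha, b, hb, rfl⟩ := mem_mul.1 ht
  exact (mul_nonneg (hf a) (hg b)).trans (hm a ha b hb)

theorem sum_mul_right_le_sum_mul [Mul Γ] [IsRightCancelMul Γ] (hf : ∀ a, 0 ≤ f a)
    (hg : ∀ b, 0 ≤ g b) (hm : ∀ a ∈ S, ∀ b ∈ T, f a * g b ≤ m (a * b)) {b : Γ} (hb : b ∈ T) :
    (∑ a ∈ S, f a) * g b ≤ ∑ t ∈ S * T, m t :=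
  calc (∑ a ∈ S, f a) * g b = ∑ a ∈ S, f a * g b := sum_mul ..
    _ ≤ ∑ a ∈ S, m (a * b) := sum_le_sum fun a ha => hm a ha b hb
    _ = ∑ t ∈ S.image (· * b), m t := (sum_image (mul_left_injective b).injOn).symm
    _ ≤ ∑ t ∈ S * T, m t := sum_le_sum_of_subset_of_nonneg
        (image_subset_iff.2 fun _ ha => mul_mem_mul ha hb)
        fun t ht _ => nonneg_of_mul_le_of_mem_mul hf hg hm t ht

theorem mul_sum_left_le_sum_mul [Mul Γ] [IsLeftCancelMul Γ] (hf : ∀ a, 0 ≤ f a)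
    (hg : ∀ b, 0 ≤ g b) (hm : ∀ a ∈ S, ∀ b ∈ T, f a * g b ≤ m (a * b)) {a : Γ} (ha : a ∈ S) :
    f a * ∑ b ∈ T, g b ≤ ∑ t ∈ S * T, m t :=
  calc f a * ∑ b ∈ T, g b = ∑ b ∈ T, f a * g b := mul_sum ..
    _ ≤ ∑ b ∈ T, m (a * b) := sum_le_sum fun b hb => hm a ha b hb
    _ = ∑ t ∈ T.image (a * ·), m t := (sum_image (mul_right_injective a).injOn).symm
    _ ≤ ∑ t ∈ S * T, m t := sum_le_sum_of_subset_of_nonneg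
        (image_subset_iff.2 fun _ hb => mul_mem_mul ha hb)
        fun t ht _ => nonneg_of_mul_le_of_mem_mul hf hg hm t ht

/- At the maxima `f a` of `f` and `g b` of `g`, the sum of `m` dominates `(∑ f) * g b` and
`f a * ∑ g`, and the weighted sums are bounded by a combination of these two products. -/
theorem isPrekopaLeindlerWeight_of_le [CancelMonoid Γ] {w : Γ → ℝ} {c σ : ℝ} (hw : ∀ t, 0 ≤ w t)
    (hw1 : w 1 ≤ 1) (hc : ∀ t ≠ 1, w t ≤ c) (hc0 : 0 ≤ c) (hσ : ∀ S : Finset Γ, ∑ t ∈ S, w t ≤ σ)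
    (hcσ : c * (1 + σ) ≤ 1) : IsPrekopaLeindlerWeight w := by
  refine ⟨hw, fun S T f g m hf hg hm => ?_⟩
  have hσ0 : 0 ≤ σ := by simpa using hσ ∅
  have hc1 : c ≤ 1 := by nlinarith [mul_nonneg hc0 hσ0]
  rcases S.eq_empty_or_nonempty with rfl | hS
  · simp
  rcases T.eq_empty_or_nonempty with rfl | hT
  · simp
  obtain ⟨a, ha, hfa⟩ := exists_max_image S f hS
  obtain ⟨b, hb, hgb⟩ := exists_max_image T g hT
  set X := ∑ t ∈ S, f t
  set Y := ∑ t ∈ T, g t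
  set Q := ∑ t ∈ T, g t * w t
  set Z := ∑ t ∈ S * T, m t
  have hXZ : X * g b ≤ Z := sum_mul_right_le_sum_mul hf hg hm hb
  have hYZ : f a * Y ≤ Z := mul_sum_left_le_sum_mul hf hg hm ha
  have hX : f a ≤ X := single_le_sum (fun t _ => hf t) ha
  have hfgZ : f a * g b ≤ Z := (mul_le_mul_of_nonneg_right hX (hg b)).trans hXZ
  have hQ : Q ≤ (1 - c) * g b + c * Y := sum_mul_weight_le hw1 hc hc1 hg hgb (hg b)
  have hQσ : Q ≤ g b * σ :=
    calc Q ≤ ∑ t ∈ T, g b * w t :=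
          sum_le_sum fun t ht => mul_le_mul_of_nonneg_right (hgb t ht) (hw t)
      _ = g b * ∑ t ∈ T, w t := (mul_sum ..).symm
      _ ≤ g b * σ := mul_le_mul_of_nonneg_left (hσ T) (hg b)
  calc (∑ t ∈ S, f t * w t) * Q
      ≤ ((1 - c) * f a + c * X) * Q := mul_le_mul_of_nonneg_right
        (sum_mul_weight_le hw1 hc hc1 hf hfa (hf a))
        (sum_nonneg fun t _ => mul_nonneg (hg t) (hw t))
    _ = f a * Q + c * (X - f a) * Q := by ring
    _ ≤ f a * ((1 - c) * g b + c * Y) + c * (X - f a) * (g b * σ) :=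
        add_le_add (mul_le_mul_of_nonneg_left hQ (hf a))
          (mul_le_mul_of_nonneg_left hQσ (mul_nonneg hc0 (sub_nonneg.2 hX)))
    _ = (1 - c * (1 + σ)) * (f a * g b) + c * (f a * Y) + c * σ * (X * g b) := by ring
    _ ≤ (1 - c * (1 + σ)) * Z + c * Z + c * σ * Z := by
        have := sub_nonneg.2 hcσ
        gcongr
    _ = Z := by ring

end Criterion

section Integers

theorem sum_Icc_inv_sq_le (N : ℕ) :
    ∑ t ∈ Icc (-(N : ℤ)) N, ((2 * t.natAbs + 1 : ℝ) ^ 2)⁻¹ ≤ 3 / 2 - (2 * (N + 1 : ℝ))⁻¹ := by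
  rw [sum_Icc_of_even_eq_range fun t => by rw [Int.natAbs_neg]]
  induction N with
  | zero => norm_num
  | succ N ih =>
    rw [sum_range_succ, smul_add]
    have hstep : 2 * ((2 * (N + 1 : ℝ) + 1) ^ 2)⁻¹ ≤ (2 * (N + 1 : ℝ))⁻¹ - (2 * (N + 2 : ℝ))⁻¹ := by
      rw [inv_sub_inv (by positivity) (by positivity), ← div_eq_mul_inv,
        div_le_div_iff₀ (by positivity) (by positivity)]
      nlinarith
    simp only [nsmul_eq_mul, Nat.cast_ofNat, Int.natAbs_natCast] at ih ⊢
    rw [Nat.cast_add_one, add_assoc (N : ℝ), one_add_one_eq_two]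
    linarith

theorem sum_inv_sq_le (S : Finset ℤ) : ∑ t ∈ S, ((2 * t.natAbs + 1 : ℝ) ^ 2)⁻¹ ≤ 3 / 2 := by
  have hS : S ⊆ Icc (-(S.sup Int.natAbs : ℕ) : ℤ) (S.sup Int.natAbs : ℕ) := by
    intro t ht
    have := le_sup (f := Int.natAbs) ht
    rw [mem_Icc]
    omega
  calc _ ≤ _ := sum_le_sum_of_subset_of_nonneg hS fun t _ _ => by positivity
    _ ≤ 3 / 2 - (2 * ((S.sup Int.natAbs : ℕ) + 1 : ℝ))⁻¹ := sum_Icc_inv_sq_le _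
    _ ≤ 3 / 2 := sub_le_self _ (by positivity)

theorem isPrekopaLeindlerWeight_int :
    IsPrekopaLeindlerWeight fun t : Multiplicative ℤ => ((2 * t.toAdd.natAbs + 1 : ℝ) ^ 2)⁻¹ := by
  refine isPrekopaLeindlerWeight_of_le (c := 1 / 9) (σ := 3 / 2) (fun t => by positivity)
    (by simp) (fun t ht => ?_) (by norm_num) (fun S => ?_) (by norm_num)
  · have ht1 : (1 : ℝ) ≤ t.toAdd.natAbs := by
      exact_mod_cast Int.natAbs_pos.2 (mt toAdd_eq_zero.1 ht)
    rw [one_div]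
    exact inv_anti₀ (by norm_num) (by nlinarith)
  · simpa only [sum_map, Equiv.coe_toEmbedding] using
      sum_inv_sq_le (S.map Multiplicative.toAdd.toEmbedding)

end Integers

section Tensor

variable {ι : Type*} {Γ : ι → Type*}

theorem exists_injOn_restrict (U : Finset (∀ i, Γ i)) :
    ∃ s : Finset ι, Set.InjOn s.restrict (U : Set (∀ i, Γ i)) := by
  classical
  have hsep (z : (∀ i, Γ i) × (∀ i, Γ i)) :
      ∃ s : Finset ι, (∀ i ∈ s, z.1 i = z.2 i) → z.1 = z.2 := by
    by_cases hz : z.1 = z.2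
    · exact ⟨∅, fun _ => hz⟩
    · obtain ⟨i, hi⟩ := Function.ne_iff.1 hz
      exact ⟨{i}, fun h => absurd (h i (mem_singleton_self i)) hi⟩
  choose s hs using hsep
  refine ⟨(U ×ˢ U).biUnion s, fun x hx y hy hxy => hs (x, y) fun i hi => ?_⟩
  exact congrFun hxy ⟨i, mem_biUnion.2 ⟨(x, y), mem_product.2 ⟨hx, hy⟩, hi⟩⟩

theorem injOn_restrict_filter_of_injOn_restrict_insert [DecidableEq ι] [∀ i, DecidableEq (Γ i)]
    {j : ι} {s : Finset ι} {W : Finset (∀ i, Γ i)}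
    (hW : Set.InjOn (insert j s).restrict (W : Set (∀ i, Γ i))) (t : Γ j) :
    Set.InjOn s.restrict (W.filter (· j = t) : Set (∀ i, Γ i)) := by
  intro x hx y hy hxy
  rw [mem_coe, mem_filter] at hx hy
  refine hW hx.1 hy.1 (funext fun ⟨i, hi⟩ => ?_)
  rcases mem_insert.1 hi with rfl | hi
  · exact hx.2.trans hy.2.symm
  · exact congrFun hxy ⟨i, hi⟩

theorem sum_prod_insert_eq_sum_fiberwise [DecidableEq ι] [∀ i, DecidableEq (Γ i)] {j : ι}
    {s : Finset ι} (hj : j ∉ s) (w : ∀ i, Γ i → ℝ) (W : Finset (∀ i, Γ i)) :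
    ∑ x ∈ W, ∏ i ∈ insert j s, w i (x i) =
      ∑ t ∈ W.image (· j), (∑ x ∈ W with x j = t, ∏ i ∈ s, w i (x i)) * w j t := by
  rw [← sum_fiberwise_of_maps_to (fun x hx => mem_image_of_mem (· j) hx)]
  refine sum_congr rfl fun t _ => ?_
  rw [sum_mul]
  refine sum_congr rfl fun x hx => ?_
  rw [prod_insert hj, (mem_filter.1 hx).2, mul_comm]

variable [∀ i, Mul (Γ i)] [DecidableEq (∀ i, Γ i)]

theorem card_mul_card_le_of_injOn_restrict_empty {U V : Finset (∀ i, Γ i)}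
    (hU : Set.InjOn (∅ : Finset ι).restrict (U : Set (∀ i, Γ i)))
    (hV : Set.InjOn (∅ : Finset ι).restrict (V : Set (∀ i, Γ i))) : #U * #V ≤ #(U * V) := by
  have hle_one {W : Finset (∀ i, Γ i)} (hW : Set.InjOn (∅ : Finset ι).restrict (W : Set _)) :
      #W ≤ 1 :=
    card_le_one.2 fun x hx y hy => hW hx hy (Subsingleton.elim _ _)
  rcases (U * V).eq_empty_or_nonempty with h | h
  · rcases mul_eq_empty.1 h with rfl | rfl <;> simp
  · exact (mul_le_one₀ (hle_one hU) (Nat.zero_le _) (hle_one hV)).trans h.card_pos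

variable [∀ i, DecidableEq (Γ i)]

theorem filter_mul_filter_subset (U V : Finset (∀ i, Γ i)) {j : ι} (a b : Γ j) :
    {x ∈ U | x j = a} * {y ∈ V | y j = b} ⊆ {z ∈ U * V | z j = a * b} := by
  intro z hz
  obtain ⟨x, hx, y, hy, rfl⟩ := mem_mul.1 hz
  rw [mem_filter] at hx hy ⊢
  exact ⟨mul_mem_mul hx.1 hy.1, by rw [Pi.mul_apply, hx.2, hy.2]⟩

theorem sum_prod_mul_sum_prod_le_card_mul {w : ∀ i, Γ i → ℝ}
    (hw : ∀ i, IsPrekopaLeindlerWeight (w i)) (s : Finset ι) (U V : Finset (∀ i, Γ i))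
    (hU : Set.InjOn s.restrict (U : Set (∀ i, Γ i)))
    (hV : Set.InjOn s.restrict (V : Set (∀ i, Γ i))) :
    (∑ x ∈ U, ∏ i ∈ s, w i (x i)) * (∑ y ∈ V, ∏ i ∈ s, w i (y i)) ≤ #(U * V) := by
  classical
  induction s using Finset.induction_on generalizing U V with
  | empty =>
    simpa only [prod_empty, sum_const, nsmul_eq_mul, mul_one] using
      mod_cast card_mul_card_le_of_injOn_restrict_empty hU hV
  | insert j s hj ih =>
    have hnonneg (W : Finset (∀ i, Γ i)) (t : Γ j) :
        0 ≤ ∑ x ∈ W with x j = t, ∏ i ∈ s, w i (x i) :=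
      sum_nonneg fun x _ => prod_nonneg fun i _ => (hw i).1 _
    have hfiber (a b : Γ j) :
        (∑ x ∈ U with x j = a, ∏ i ∈ s, w i (x i)) * (∑ y ∈ V with y j = b, ∏ i ∈ s, w i (y i)) ≤
          #{z ∈ U * V | z j = a * b} :=
      (ih _ _ (injOn_restrict_filter_of_injOn_restrict_insert hU a)
        (injOn_restrict_filter_of_injOn_restrict_insert hV b)).trans
        (mod_cast card_le_card (filter_mul_filter_subset U V a b))
    rw [sum_prod_insert_eq_sum_fiberwise hj w U, sum_prod_insert_eq_sum_fiberwise hj w V]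
    calc _ ≤ ∑ t ∈ U.image (· j) * V.image (· j), (#{z ∈ U * V | z j = t} : ℝ) :=
          (hw j).2 _ _ _ _ _ (hnonneg U) (hnonneg V) fun a _ b _ => hfiber a b
      _ = #(U * V) := by
          rw [← Nat.cast_sum, ← card_eq_sum_card_fiberwise]
          intro z hz
          obtain ⟨x, hx, y, hy, rfl⟩ := mem_mul.1 hz
          exact mul_mem_mul (mem_image_of_mem _ hx) (mem_image_of_mem _ hy)

end Tensor

section Bounds

variable {ι : Type*}

theorem card_mul_card_le_of_prod_le [DecidableEq (ι → Multiplicative ℤ)] {E : ℕ}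
    {U V : Finset (ι → Multiplicative ℤ)}
    (hE : ∀ x ∈ U ∪ V, ∀ s : Finset ι, ∏ i ∈ s, (2 * (x i).toAdd.natAbs + 1) ≤ E) :
    #U * #V ≤ E ^ 4 * #(U * V) := by
  obtain ⟨s, hs⟩ := exists_injOn_restrict (U ∪ V)
  have hsum {W : Finset (ι → Multiplicative ℤ)} (hW : W ⊆ U ∪ V) :
      #W * ((E : ℝ) ^ 2)⁻¹ ≤ ∑ x ∈ W, ∏ i ∈ s, ((2 * (x i).toAdd.natAbs + 1 : ℝ) ^ 2)⁻¹ := by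
    rw [← nsmul_eq_mul]
    refine card_nsmul_le_sum _ _ _ fun x hx => ?_
    rw [prod_inv_distrib, prod_pow]
    gcongr
    exact_mod_cast hE x (hW hx) s
  have hmul := (mul_le_mul (hsum subset_union_left) (hsum subset_union_right) (by positivity)
    (sum_nonneg fun x _ => prod_nonneg fun i _ => by positivity)).trans
    (sum_prod_mul_sum_prod_le_card_mul (fun _ => isPrekopaLeindlerWeight_int) s U V
      (hs.mono (mod_cast subset_union_left)) (hs.mono (mod_cast subset_union_right)))
  rcases E.eq_zero_or_pos with rfl | hE0
  · have hempty : U ∪ V = ∅ := eq_empty_of_forall_notMem fun x hx => by simpa using hE x hx ∅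
    rw [(union_eq_empty.1 hempty).1]
    simp
  have hcast : (#U * #V : ℝ) ≤ E ^ 4 * #(U * V) := by
    calc (#U * #V : ℝ) = E ^ 4 * (#U * ((E : ℝ) ^ 2)⁻¹ * (#V * ((E : ℝ) ^ 2)⁻¹)) := by field_simp
      _ ≤ E ^ 4 * #(U * V) := by gcongr
  exact_mod_cast hcast

theorem card_le_mul_card_image_of_ker {G H : Type*} [Group G] [Group H] [DecidableEq H]
    (φ : G →* H) {R : ℕ} (hR : ∀ C : Finset G, (∀ x ∈ C, φ x = 1) → #C ≤ R) (A : Finset G) :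
    #A ≤ R * #(A.image φ) := by
  refine card_le_mul_card_image A R fun y hy => ?_
  obtain ⟨x, -, rfl⟩ := mem_image.1 hy
  rw [← card_map (mulRightEmbedding x⁻¹)]
  refine hR _ fun z hz => ?_
  obtain ⟨a, ha, rfl⟩ := mem_map.1 hz
  rw [mulRightEmbedding_apply, map_mul, map_inv, (mem_filter.1 ha).2, mul_inv_cancel]

theorem card_mul_card_le_of_monoidHom {G : Type*} [Group G] [DecidableEq G]
    (φ : ι → G →* Multiplicative ℤ) {R E : ℕ} {A B : Finset G}
    (hR : ∀ C : Finset G, (∀ x ∈ C, ∀ i, φ i x = 1) → #C ≤ R)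
    (hE : ∀ x ∈ A ∪ B, ∀ s : Finset ι, ∏ i ∈ s, (2 * (φ i x).toAdd.natAbs + 1) ≤ E) :
    #A * #B ≤ R ^ 2 * E ^ 4 * #(A * B) := by
  classical
  let Φ : G →* ι → Multiplicative ℤ := MonoidHom.pi φ
  have hΦ := card_le_mul_card_image_of_ker Φ fun C hC => hR C fun x hx => congrFun (hC x hx)
  have himage : #(A.image Φ) * #(B.image Φ) ≤ E ^ 4 * #(A.image Φ * B.image Φ) := by
    refine card_mul_card_le_of_prod_le fun y hy => ?_
    rw [← image_union] at hy
    obtain ⟨x, hx, rfl⟩ := mem_image.1 hy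
    exact hE x hx
  calc #A * #B ≤ R * #(A.image Φ) * (R * #(B.image Φ)) := Nat.mul_le_mul (hΦ A) (hΦ B)
    _ = R ^ 2 * (#(A.image Φ) * #(B.image Φ)) := by ring
    _ ≤ R ^ 2 * (E ^ 4 * #(A.image Φ * B.image Φ)) := by gcongr
    _ = R ^ 2 * E ^ 4 * #((A * B).image Φ) := by rw [image_mul, mul_assoc]
    _ ≤ R ^ 2 * E ^ 4 * #(A * B) := by gcongr; exact card_image_le

theorem prod_two_mul_add_one_le {deg x : ι → ℕ} {M c m : ℕ} {s : Finset ι}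
    (hdeg : ∀ i ∈ s, 1 ≤ deg i) (hM : ∑ i ∈ s, deg i * x i ≤ M) (hc : #{i ∈ s | deg i ≤ m} ≤ c) :
    ∏ i ∈ s, (2 * x i + 1) ≤ (2 * M + 1) ^ c * 3 ^ (M / (m + 1)) := by
  have hlow : ∏ i ∈ s with deg i ≤ m, (2 * x i + 1) ≤ (2 * M + 1) ^ c := by
    have hx (i) (hi : i ∈ s) : x i ≤ M :=
      (Nat.le_mul_of_pos_left _ (hdeg i hi)).trans
        ((single_le_sum (f := fun i => deg i * x i) (fun _ _ => Nat.zero_le _) hi).trans hM)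
    calc _ ≤ (2 * M + 1) ^ #{i ∈ s | deg i ≤ m} :=
          prod_le_pow_card _ _ _ fun i hi => by have := hx i (mem_of_mem_filter i hi); omega
      _ ≤ (2 * M + 1) ^ c := Nat.pow_le_pow_right (Nat.succ_pos _) hc
  have hhigh : ∏ i ∈ s with ¬ deg i ≤ m, (2 * x i + 1) ≤ 3 ^ (M / (m + 1)) := by
    have hsum : ∑ i ∈ s with ¬ deg i ≤ m, x i ≤ M / (m + 1) := by
      rw [Nat.le_div_iff_mul_le (Nat.succ_pos m), sum_mul]
      calc _ ≤ ∑ i ∈ s with ¬ deg i ≤ m, deg i * x i := sum_le_sum fun i hi => by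
            rw [mul_comm]
            exact Nat.mul_le_mul_right _ (not_le.1 (mem_filter.1 hi).2)
        _ ≤ ∑ i ∈ s, deg i * x i := sum_le_sum_of_subset (filter_subset _ _)
        _ ≤ M := hM
    calc _ ≤ ∏ i ∈ s with ¬ deg i ≤ m, 3 ^ x i := prod_le_prod' fun i _ => by
          calc 2 * x i + 1 = 1 + x i * 2 := by ring
            _ ≤ 3 ^ x i := one_add_mul_le_pow_of_sq_nonneg (Nat.zero_le _) (Nat.zero_le _)
              (Nat.zero_le _) _
      _ = 3 ^ ∑ i ∈ s with ¬ deg i ≤ m, x i := prod_pow_eq_pow_sum ..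
      _ ≤ 3 ^ (M / (m + 1)) := Nat.pow_le_pow_right three_pos hsum
  rw [← prod_filter_mul_prod_filter_not s (deg · ≤ m)]
  exact Nat.mul_le_mul hlow hhigh

end Bounds

theorem card_pow_le_of_card_pow_mul_card_le {M : Type*} [Monoid M] [DecidableEq M] {A : Finset M}
    {E : ℝ} (hE : 0 ≤ E) {ν : ℕ} (hA : ∀ j < ν, (#(A ^ j) * #A : ℝ) ≤ E * #(A ^ (j + 1))) :
    (#A : ℝ) ^ ν ≤ E ^ ν * #(A ^ ν) := by
  induction ν with
  | zero => simp
  | succ ν ih =>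
    calc (#A : ℝ) ^ (ν + 1) = #A ^ ν * #A := pow_succ _ _
      _ ≤ E ^ ν * #(A ^ ν) * #A := by
          gcongr
          exact ih fun j hj => hA j (hj.trans ν.lt_succ_self)
      _ = E ^ ν * (#(A ^ ν) * #A) := mul_assoc _ _ _
      _ ≤ E ^ ν * (E * #(A ^ (ν + 1))) :=
          mul_le_mul_of_nonneg_left (hA ν ν.lt_succ_self) (pow_nonneg hE ν)
      _ = E ^ (ν + 1) * #(A ^ (ν + 1)) := by rw [pow_succ E, mul_assoc]

end ProductSet

namespace FunctionFieldHeight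

open Polynomial IsDedekindDomain Module

section Places

variable {F S : Type*} [Field F] [CommRing S] [Algebra F[X] S]

variable (F) in
/-- A generator of the prime of `F[X]` below a place. -/
noncomputable def primeBelow (v : HeightOneSpectrum S) : F[X] :=
  Submodule.IsPrincipal.generator (v.asIdeal.under F[X])

variable (F) in
/-- The degree of the prime of `F[X]` below a place. This is not the degree of the residue field of
the place, which may be larger. -/
noncomputable def placeDegree (v : HeightOneSpectrum S) : ℕ := (primeBelow F v).natDegree

theorem span_primeBelow (v : HeightOneSpectrum S) :
    Ideal.span {primeBelow F v} = v.asIdeal.under F[X] :=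
  Ideal.span_singleton_generator _

theorem algebraMap_primeBelow_mem (v : HeightOneSpectrum S) :
    algebraMap F[X] S (primeBelow F v) ∈ v.asIdeal :=
  Submodule.IsPrincipal.generator_mem (v.asIdeal.under F[X])

theorem under_eq_span_of_mem {v : HeightOneSpectrum S} {p : F[X]} (hp : Irreducible p)
    (hv : algebraMap F[X] S p ∈ v.asIdeal) : v.asIdeal.under F[X] = Ideal.span {p} := by
  have := v.isPrime
  exact ((PrincipalIdealRing.isMaximal_of_irreducible hp).eq_of_le
    (Ideal.IsPrime.ne_top inferInstance) ((Ideal.span_singleton_le_iff_mem _).2 hv)).symm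

theorem placeDegree_eq_natDegree_of_mem {v : HeightOneSpectrum S} {p : F[X]} (hp : Irreducible p)
    (hv : algebraMap F[X] S p ∈ v.asIdeal) : placeDegree F v = p.natDegree := by
  have hspan : Ideal.span {primeBelow F v} = Ideal.span {p} := by
    rw [span_primeBelow, under_eq_span_of_mem hp hv]
  exact natDegree_eq_of_degree_eq
    (degree_eq_degree_of_associated (Ideal.span_singleton_eq_span_singleton.1 hspan))

variable [IsDedekindDomain S]

theorem irreducible_primeBelow [Algebra.IsIntegral F[X] S] (v : HeightOneSpectrum S) :
    Irreducible (primeBelow F v) := by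
  have := v.isPrime
  exact (Submodule.IsPrincipal.prime_generator_of_isPrime _
    (Ideal.under_ne_bot F[X] v.ne_bot)).irreducible

theorem placeDegree_pos [Algebra.IsIntegral F[X] S] (v : HeightOneSpectrum S) :
    0 < placeDegree F v :=
  (irreducible_primeBelow v).natDegree_pos

theorem multiplicity_span_ne_zero_iff {v : HeightOneSpectrum S} {x : S} :
    multiplicity v.asIdeal (Ideal.span {x}) ≠ 0 ↔ x ∈ v.asIdeal := by
  rw [multiplicity_ne_zero, Ideal.dvd_span_singleton]

theorem multiplicity_span_mul (v : HeightOneSpectrum S) {x y : S} (hx : x ≠ 0) (hy : y ≠ 0) :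
    multiplicity v.asIdeal (Ideal.span {x * y}) =
      multiplicity v.asIdeal (Ideal.span {x}) + multiplicity v.asIdeal (Ideal.span {y}) := by
  rw [← Ideal.span_singleton_mul_span_singleton]
  refine multiplicity_mul v.prime (FiniteMultiplicity.of_prime_left v.prime ?_)
  simp [hx, hy]

variable [Module.IsTorsionFree F[X] S] [Module.Finite F[X] S]

theorem sum_multiplicity_le_finrank {p : F[X]} (hp : Irreducible p)
    {s : Finset (HeightOneSpectrum S)} (hs : ∀ v ∈ s, algebraMap F[X] S p ∈ v.asIdeal) :
    ∑ v ∈ s, multiplicity v.asIdeal (Ideal.span {algebraMap F[X] S p}) ≤ finrank F[X] S := by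
  classical
  have := PrincipalIdealRing.isMaximal_of_irreducible hp
  have hp0 : Ideal.span {p} ≠ ⊥ := mt Ideal.span_singleton_eq_bot.1 hp.ne_zero
  have := Fintype.ofFinite ((Ideal.span {p}).primesOver S)
  have hlies (v : s) : v.1.asIdeal ∈ (Ideal.span {p}).primesOver S :=
    ⟨v.1.isPrime, ⟨(under_eq_span_of_mem hp (hs v.1 v.2)).symm⟩⟩
  have hinj : Set.InjOn (fun v : s => (⟨v.1.asIdeal, hlies v⟩ : (Ideal.span {p}).primesOver S))
      (s.attach : Set s) := fun v _ w _ h =>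
    Subtype.ext (HeightOneSpectrum.ext (congrArg Subtype.val h))
  calc ∑ v ∈ s, multiplicity v.asIdeal (Ideal.span {algebraMap F[X] S p})
      = ∑ v ∈ s.attach, multiplicity v.1.asIdeal (Ideal.span {algebraMap F[X] S p}) :=
        (Finset.sum_attach s _).symm
    _ ≤ ∑ v ∈ s.attach, v.1.asIdeal.ramificationIdx F[X] * v.1.asIdeal.inertiaDeg F[X] := by
        refine Finset.sum_le_sum fun v _ => ?_
        have := v.1.isPrime
        have : v.1.asIdeal.LiesOver (Ideal.span {p}) := (hlies v).2
        rw [Ideal.IsDedekindDomain.ramificationIdx_eq_multiplicity (Ideal.span {p}) _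
          (Ideal.map_ne_bot_of_ne_bot hp0), Ideal.map_span, Set.image_singleton]
        exact Nat.le_mul_of_pos_right _ (Ideal.inertiaDeg_pos _ _)
    _ = ∑ q ∈ s.attach.image fun v => (⟨v.1.asIdeal, hlies v⟩ : (Ideal.span {p}).primesOver S),
          q.1.ramificationIdx F[X] * q.1.inertiaDeg F[X] := (Finset.sum_image
          (f := fun q => q.1.ramificationIdx F[X] * q.1.inertiaDeg F[X]) hinj).symm
    _ ≤ ∑ q : (Ideal.span {p}).primesOver S, q.1.ramificationIdx F[X] * q.1.inertiaDeg F[X] :=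
        Finset.sum_le_sum_of_subset (Finset.subset_univ _)
    _ = finrank F[X] S := Ideal.sum_ramification_inertia_eq_finrank (Ideal.span {p}) S

theorem sum_placeDegree_mul_multiplicity_le_of_irreducible {p : F[X]} (hp : Irreducible p)
    (s : Finset (HeightOneSpectrum S)) :
    ∑ v ∈ s, placeDegree F v * multiplicity v.asIdeal (Ideal.span {algebraMap F[X] S p}) ≤
      finrank F[X] S * p.natDegree := by
  classical
  have hterm (v : HeightOneSpectrum S) :
      placeDegree F v * multiplicity v.asIdeal (Ideal.span {algebraMap F[X] S p}) =
        if algebraMap F[X] S p ∈ v.asIdeal then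
          multiplicity v.asIdeal (Ideal.span {algebraMap F[X] S p}) * p.natDegree else 0 := by
    split_ifs with h
    · rw [placeDegree_eq_natDegree_of_mem hp h, mul_comm]
    · rw [not_ne_iff.1 (mt multiplicity_span_ne_zero_iff.1 h), mul_zero]
  rw [Finset.sum_congr rfl fun v _ => hterm v, ← Finset.sum_filter, ← Finset.sum_mul]
  exact Nat.mul_le_mul_right _
    (sum_multiplicity_le_finrank hp fun v hv => (Finset.mem_filter.1 hv).2)

theorem sum_placeDegree_mul_multiplicity_le (s : Finset (HeightOneSpectrum S)) {a : F[X]}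
    (ha : a ≠ 0) :
    ∑ v ∈ s, placeDegree F v * multiplicity v.asIdeal (Ideal.span {algebraMap F[X] S a}) ≤
      finrank F[X] S * a.natDegree := by
  have hne {a : F[X]} : a ≠ 0 → algebraMap F[X] S a ≠ 0 :=
    (map_ne_zero_iff _ (FaithfulSMul.algebraMap_injective _ _)).2
  induction a using UniqueFactorizationMonoid.induction_on_prime with
  | h₁ => exact absurd rfl ha
  | h₂ a hu =>
    have hmem (v : HeightOneSpectrum S) : algebraMap F[X] S a ∉ v.asIdeal := fun h =>
      v.isPrime.ne_top (Ideal.eq_top_of_isUnit_mem _ h (hu.map _))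
    refine (Finset.sum_eq_zero fun v _ => ?_).trans_le (Nat.zero_le _)
    rw [not_ne_iff.1 (mt multiplicity_span_ne_zero_iff.1 (hmem v)), mul_zero]
  | h₃ a p ha0 hp ih =>
    simp only [map_mul, multiplicity_span_mul _ (hne hp.ne_zero) (hne ha0), mul_add,
      Finset.sum_add_distrib, natDegree_mul hp.ne_zero ha0]
    exact add_le_add (sum_placeDegree_mul_multiplicity_le_of_irreducible hp.irreducible s) (ih ha0)

theorem card_le_card_pow_of_natDegree_le [Finite F] {m : ℕ} {s : Finset F[X]}
    (hs : ∀ p ∈ s, p.natDegree ≤ m) : s.card ≤ Nat.card F ^ (m + 1) := by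
  have hmem (p : s) : p.1 ∈ degreeLT F (m + 1) :=
    mem_degreeLT.2 (degree_le_natDegree.trans_lt (mod_cast Nat.lt_succ_of_le (hs p p.2)))
  have : Finite (degreeLT F (m + 1)) := .of_equiv _ (degreeLTEquiv F (m + 1)).symm.toEquiv
  calc s.card = Nat.card s := (Nat.card_eq_finsetCard s).symm
    _ ≤ Nat.card (degreeLT F (m + 1)) := Nat.card_le_card_of_injective (fun p => ⟨p.1, hmem p⟩)
        fun _ _ h => Subtype.ext (Subtype.mk.inj h)
    _ = Nat.card (Fin (m + 1) → F) := Nat.card_congr (degreeLTEquiv F (m + 1)).toEquiv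
    _ = Nat.card F ^ (m + 1) := by rw [Nat.card_fun, Nat.card_fin]

theorem card_le_of_placeDegree_le [Finite F] {m : ℕ} {s : Finset (HeightOneSpectrum S)}
    (hs : ∀ v ∈ s, placeDegree F v ≤ m) : s.card ≤ finrank F[X] S * Nat.card F ^ (m + 1) := by
  classical
  have hfib (p : F[X]) (hp : p ∈ s.image (primeBelow F)) :
      (s.filter (primeBelow F · = p)).card ≤ finrank F[X] S := by
    obtain ⟨v, -, rfl⟩ := Finset.mem_image.1 hp
    have hmem (w) (hw : w ∈ s.filter (primeBelow F · = primeBelow F v)) :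
        algebraMap F[X] S (primeBelow F v) ∈ w.asIdeal :=
      (Finset.mem_filter.1 hw).2 ▸ algebraMap_primeBelow_mem w
    rw [Finset.card_eq_sum_ones]
    exact (Finset.sum_le_sum fun w hw =>
      Nat.one_le_iff_ne_zero.2 (multiplicity_span_ne_zero_iff.2 (hmem w hw))).trans
      (sum_multiplicity_le_finrank (irreducible_primeBelow v) hmem)
  refine (Finset.card_le_mul_card_image s _ hfib).trans
    (Nat.mul_le_mul_left _ (card_le_card_pow_of_natDegree_le fun p hp => ?_))
  obtain ⟨v, hv, rfl⟩ := Finset.mem_image.1 hp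
  exact hs v hv

end Places

section Valuation

variable {S L : Type*} [CommRing S] [IsDedekindDomain S] [Field L] [Algebra S L]
  [IsFractionRing S L]

theorem exists_algebraMap_eq_of_valuationOfNeZero_eq_one {x : Lˣ}
    (hx : ∀ v : HeightOneSpectrum S, v.valuationOfNeZero x = 1) : ∃ y : S, algebraMap S L y = x :=
  HeightOneSpectrum.mem_integers_of_valuation_le_one L x fun v => by
    rw [← HeightOneSpectrum.valuationOfNeZero_eq, hx v, WithZero.coe_one]

theorem toAdd_valuationOfNeZero_le {v : HeightOneSpectrum S} {x : Lˣ} {a y : S} (ha : a ≠ 0)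
    (hy : algebraMap S L y = algebraMap S L a * x) :
    (v.valuationOfNeZero x).toAdd ≤ multiplicity v.asIdeal (Ideal.span {a}) := by
  have hle : v.valuation L (algebraMap S L a * x) ≤ 1 := hy ▸ v.valuation_le_one y
  rw [map_mul, HeightOneSpectrum.valuation_of_algebraMap,
    HeightOneSpectrum.intValuation_eq_exp_neg_multiplicity v ha,
    ← HeightOneSpectrum.valuationOfNeZero_eq] at hle
  have hexp : WithZero.exp (-(multiplicity v.asIdeal (Ideal.span {a}) : ℤ) +
      (v.valuationOfNeZero x).toAdd) ≤ WithZero.exp 0 := hle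
  linarith [WithZero.exp_le_exp.1 hexp]

theorem natAbs_valuationOfNeZero_le {v : HeightOneSpectrum S} {x : Lˣ} {a y z : S} (ha : a ≠ 0)
    (hy : algebraMap S L y = algebraMap S L a * x)
    (hz : algebraMap S L z = algebraMap S L a * ↑x⁻¹) :
    (v.valuationOfNeZero x).toAdd.natAbs ≤ multiplicity v.asIdeal (Ideal.span {a}) := by
  have hinv := toAdd_valuationOfNeZero_le (v := v) ha hz
  have := toAdd_valuationOfNeZero_le (v := v) ha hy
  rw [map_inv, toAdd_inv] at hinv
  omega

end Valuation

section Denominators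

variable {F L : Type*} [Field F] [Field L]

/-- `x` and `x⁻¹` become integral over `F[X]`, embedded in `L` by `g`, after multiplication by some
nonzero polynomial of degree at most `n`. -/
def HasDenominator (g : F[X] →+* L) (n : ℕ) (x : Lˣ) : Prop :=
  ∃ a : F[X], a ≠ 0 ∧ a.natDegree ≤ n ∧
    g.IsIntegralElem (g a * x) ∧ g.IsIntegralElem (g a * ↑x⁻¹)

theorem HasDenominator.mono {g : F[X] →+* L} {m n : ℕ} {x : Lˣ} (hx : HasDenominator g m x)
    (hmn : m ≤ n) : HasDenominator g n x := by
  obtain ⟨a, ha, hdeg, hint⟩ := hx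
  exact ⟨a, ha, hdeg.trans hmn, hint⟩

theorem hasDenominator_one (g : F[X] →+* L) : HasDenominator g 0 1 :=
  ⟨1, one_ne_zero, natDegree_one.le, by simpa using g.isIntegralElem_one,
    by simpa using g.isIntegralElem_one⟩

theorem HasDenominator.mul {g : F[X] →+* L} {m n : ℕ} {x y : Lˣ} (hx : HasDenominator g m x)
    (hy : HasDenominator g n y) : HasDenominator g (m + n) (x * y) := by
  obtain ⟨a, ha, ham, hax, hax'⟩ := hx
  obtain ⟨b, hb, hbn, hby, hby'⟩ := hy
  refine ⟨a * b, mul_ne_zero ha hb, natDegree_mul_le_of_le ham hbn, ?_, ?_⟩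
  · rw [map_mul, Units.val_mul, mul_mul_mul_comm]
    exact hax.mul g hby
  · rw [map_mul, mul_inv, Units.val_mul, mul_mul_mul_comm]
    exact hax'.mul g hby'

theorem isIntegralElem_comp_iff {E : Type*} [Field E] {g : F[X] →+* E} (i : E →+* L) {y : E} :
    (i.comp g).IsIntegralElem (i y) ↔ g.IsIntegralElem y := by
  simp only [RingHom.IsIntegralElem, ← hom_eval₂, map_eq_zero_iff i i.injective]

theorem isIntegralElem_pow_iff {g : F[X] →+* L} {x : L} {N : ℕ} (hN : 0 < N) :
    g.IsIntegralElem (x ^ N) ↔ g.IsIntegralElem x := by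
  let := g.toAlgebra
  exact IsIntegral.pow_iff (R := F[X]) hN

theorem HasDenominator.map_of_pow {E : Type*} [Field E] {g : F[X] →+* E} {i : E →+* L}
    {φ : L →+* E} {N n : ℕ} (hN : 0 < N) (hφ : ∀ x, i (φ x) = x ^ N) {x : Lˣ}
    (hx : HasDenominator (i.comp g) n x) : HasDenominator g (N * n) (Units.map φ x) := by
  obtain ⟨a, ha, hdeg, hax, hax'⟩ := hx
  have hint {z : L} (hz : (i.comp g).IsIntegralElem (i.comp g a * z)) :
      g.IsIntegralElem (g (a ^ N) * φ z) := by
    rwa [← isIntegralElem_comp_iff i, map_mul, hφ, map_pow, map_pow, ← mul_pow,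
      isIntegralElem_pow_iff hN]
  exact ⟨a ^ N, pow_ne_zero N ha, natDegree_pow_le_of_le N hdeg, hint hax, hint hax'⟩

end Denominators

section PlaceSystem

/-- A family of valuations on `L` which detects integrality over `F[X]`, embedded in `L` by `g`,
gives elements with a denominator of degree `n` total size at most `D * n`, and has at most
`D * q ^ (m + 1)` members of degree at most `m`, where `q` is the cardinality of `F`. -/
structure PlaceSystem {F : Type*} [Field F] {L : Type v} [Field L] (g : F[X] →+* L)
    (D : ℕ) where
  Place : Type v
  ord : Place → Lˣ →* Multiplicative ℤ
  deg : Place → ℕ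
  deg_pos : ∀ i, 0 < deg i
  isIntegralElem_of_ord_eq_one : ∀ {x : Lˣ}, (∀ i, ord i x = 1) → g.IsIntegralElem x
  sum_le : ∀ {n : ℕ} {x : Lˣ}, HasDenominator g n x → ∀ s : Finset Place,
    ∑ i ∈ s, deg i * (ord i x).toAdd.natAbs ≤ D * n
  card_le : ∀ {m : ℕ} {s : Finset Place}, (∀ i ∈ s, deg i ≤ m) →
    s.card ≤ D * Nat.card F ^ (m + 1)

variable {F : Type*} [Field F]

/-- The places of a Dedekind domain that is the integral closure of `F[X]` in its fraction
field. -/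
noncomputable def PlaceSystem.ofDedekind [Finite F] (S : Type v) {L : Type v} [CommRing S]
    [IsDedekindDomain S] [Field L] [Algebra S L] [IsFractionRing S L] [Algebra F[X] S]
    [Algebra F[X] L] [IsScalarTower F[X] S L] [IsIntegralClosure S F[X] L]
    [Module.IsTorsionFree F[X] S] [Module.Finite F[X] S] :
    PlaceSystem (algebraMap F[X] L) (finrank F[X] S) where
  Place := HeightOneSpectrum S
  ord := HeightOneSpectrum.valuationOfNeZero
  deg := placeDegree F
  deg_pos := placeDegree_pos
  isIntegralElem_of_ord_eq_one hx :=
    IsIntegralClosure.isIntegral_iff.2 (exists_algebraMap_eq_of_valuationOfNeZero_eq_one hx)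
  sum_le := by
    rintro n x ⟨a, ha, hdeg, hax, hax'⟩ s
    obtain ⟨y, hy⟩ := (IsIntegralClosure.isIntegral_iff (A := S)).1 hax
    obtain ⟨z, hz⟩ := (IsIntegralClosure.isIntegral_iff (A := S)).1 hax'
    rw [IsScalarTower.algebraMap_apply F[X] S L] at hy hz
    have ha' : algebraMap F[X] S a ≠ 0 :=
      (map_ne_zero_iff _ (FaithfulSMul.algebraMap_injective _ _)).2 ha
    calc ∑ v ∈ s, placeDegree F v * (v.valuationOfNeZero x).toAdd.natAbs
        ≤ ∑ v ∈ s, placeDegree F v * multiplicity v.asIdeal (Ideal.span {algebraMap F[X] S a}) :=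
          Finset.sum_le_sum fun v _ =>
            Nat.mul_le_mul_left _ (natAbs_valuationOfNeZero_le ha' hy hz)
      _ ≤ finrank F[X] S * a.natDegree := sum_placeDegree_mul_multiplicity_le s ha
      _ ≤ finrank F[X] S * n := Nat.mul_le_mul_left _ hdeg
  card_le := card_le_of_placeDegree_le

/-- The valuations of a subfield `E` of `L` pulled back along a power map from `L` to `E`. -/
noncomputable def PlaceSystem.ofPow {E L : Type v} [Field E] [Field L] {g : F[X] →+* E}
    {D D' N : ℕ} (P : PlaceSystem g D) (i : E →+* L) (φ : L →+* E) (hN : 0 < N)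
    (hφ : ∀ x, i (φ x) = x ^ N) (hD : D * N ≤ D') : PlaceSystem (i.comp g) D' where
  Place := P.Place
  ord v := (P.ord v).comp (Units.map φ)
  deg := P.deg
  deg_pos := P.deg_pos
  isIntegralElem_of_ord_eq_one {x} hx := by
    have hφx : g.IsIntegralElem (φ x) :=
      P.isIntegralElem_of_ord_eq_one (x := Units.map (φ : L →* E) x) hx
    rwa [← isIntegralElem_comp_iff i, hφ, isIntegralElem_pow_iff hN] at hφx
  sum_le {n _} hx s := (P.sum_le (hx.map_of_pow hN hφ) s).trans <| by
    rw [← mul_assoc]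
    exact Nat.mul_le_mul_right n hD
  card_le hs := (P.card_le hs).trans <|
    Nat.mul_le_mul_right _ ((Nat.le_mul_of_pos_right D hN).trans hD)

variable [Finite F] (k : Type*) [Field k] [Algebra F[X] k] [IsFractionRing F[X] k]

theorem nonempty_placeSystem_of_isSeparable (L : Type v) [Field L] [Algebra k L]
    [Algebra F[X] L] [IsScalarTower F[X] k L] [FiniteDimensional k L] [Algebra.IsSeparable k L] :
    Nonempty (PlaceSystem (algebraMap F[X] L) (finrank k L)) := by
  let S := integralClosure F[X] L
  have : IsDedekindDomain S := integralClosure.isDedekindDomain F[X] k L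
  have : IsFractionRing S L := IsIntegralClosure.isFractionRing_of_finite_extension F[X] k L S
  have : Module.IsTorsionFree F[X] L := .trans_faithfulSMul F[X] k L
  have : Module.IsTorsionFree F[X] S := IsIntegralClosure.isTorsionFree F[X] L
  have : Module.Finite F[X] S := IsIntegralClosure.finite F[X] k L S
  exact ⟨IsIntegralClosure.rank F[X] k L S ▸ PlaceSystem.ofDedekind S⟩

theorem expChar_pow_exponent_le_finrank (K L : Type*) [Field K] [Field L] [Algebra K L]
    [FiniteDimensional K L] [IsPurelyInseparable K L] (p : ℕ) [ExpChar K p] :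
    p ^ IsPurelyInseparable.exponent K L ≤ finrank K L := by
  cases h : IsPurelyInseparable.exponent K L with
  | zero => exact (pow_zero p).trans_le finrank_pos
  | succ e =>
    obtain ⟨a, ha⟩ := IsPurelyInseparable.exponent_min' p (e.lt_succ_self.trans_eq h.symm)
    have he : e < IsPurelyInseparable.elemExponent K a :=
      lt_of_not_ge fun hle => ha <| by
        rw [← Nat.add_sub_cancel' hle, pow_add, pow_mul]
        exact pow_mem (IsPurelyInseparable.elemExponent_def' K p a) _
    calc p ^ (e + 1) ≤ p ^ IsPurelyInseparable.elemExponent K a :=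
          Nat.pow_le_pow_right (expChar_pos K p) he
      _ = (minpoly K a).natDegree := (IsPurelyInseparable.minpoly_natDegree_eq' K p a).symm
      _ ≤ finrank K L := minpoly.natDegree_le a

theorem exists_ringHom_algebraMap_eq_pow (K L : Type*) [Field K] [Field L] [Algebra K L]
    [FiniteDimensional K L] [IsPurelyInseparable K L] :
    ∃ (φ : L →+* K) (N : ℕ), 0 < N ∧ N ≤ finrank K L ∧ ∀ x, algebraMap K L (φ x) = x ^ N := by
  obtain ⟨p, _⟩ := ExpChar.exists K
  exact ⟨IsPurelyInseparable.iterateFrobenius K L p le_rfl, _,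
    expChar_pow_pos K p (IsPurelyInseparable.exponent K L),
    expChar_pow_exponent_le_finrank K L p,
    IsPurelyInseparable.algebraMap_iterateFrobenius K p le_rfl⟩

theorem nonempty_placeSystem (L : Type v) [Field L] [Algebra k L] [Algebra F[X] L]
    [IsScalarTower F[X] k L] [FiniteDimensional k L] :
    Nonempty (PlaceSystem (algebraMap F[X] L) (finrank k L)) := by
  let E := separableClosure k L
  let : Algebra F[X] E := ((algebraMap k E).comp (algebraMap F[X] k)).toAlgebra
  have : IsScalarTower F[X] k E := IsScalarTower.of_algebraMap_eq fun _ => rfl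
  have hcomp : (algebraMap E L).comp (algebraMap F[X] E) = algebraMap F[X] L :=
    (IsScalarTower.algebraMap_eq F[X] k L).symm
  obtain ⟨P⟩ := nonempty_placeSystem_of_isSeparable (F := F) k E
  obtain ⟨φ, N, hN, hNle, hφ⟩ := exists_ringHom_algebraMap_eq_pow E L
  have hD : finrank k E * N ≤ finrank k L :=
    (Nat.mul_le_mul_left _ hNle).trans (finrank_mul_finrank k E L).le
  exact ⟨hcomp ▸ P.ofPow (algebraMap E L) φ hN hφ hD⟩

end PlaceSystem

section IsFractionHom

/-- `k` is the field of fractions of the image of the injective homomorphism `g`. A predicate on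
homomorphisms, since `F(X)` is the fraction field of `F[X]` in two ways that matter. -/
def IsFractionHom {R k : Type*} [CommRing R] [Field k] (g : R →+* k) : Prop :=
  letI := g.toAlgebra
  IsFractionRing R k

theorem IsFractionHom.of_injective {R k : Type*} [CommRing R] [Field k] {g : R →+* k}
    (hg : Function.Injective g) (hdiv : ∀ z, ∃ x y, z = g x / g y) : IsFractionHom g := by
  let := g.toAlgebra
  have : FaithfulSMul R k := (faithfulSMul_iff_algebraMap_injective R k).2 hg
  exact IsFractionRing.of_field R k hdiv

variable {F k : Type*} [Field F] [Field k] {g : F[X] →+* k}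

theorem isFractionHom_algebraMap : IsFractionHom (algebraMap F[X] (RatFunc F)) :=
  .of_injective (RatFunc.algebraMap_injective F)
    fun z => ⟨z.num, z.denom, (RatFunc.num_div_denom z).symm⟩

theorem IsFractionHom.minpoly_mem_lifts (hg : IsFractionHom g) {L : Type*} [Field L] [Algebra k L]
    {x : L} (hx : ((algebraMap k L).comp g).IsIntegralElem x) : minpoly k x ∈ lifts g := by
  let := g.toAlgebra
  let := ((algebraMap k L).comp g).toAlgebra
  have : IsFractionRing F[X] k := hg
  have : IsScalarTower F[X] k L := .of_algebraMap_eq fun _ => rfl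
  exact (mem_lifts _).2 ⟨_, (minpoly.isIntegrallyClosed_eq_field_fractions' k hx).symm⟩

theorem IsFractionHom.nonempty_placeSystem [Finite F] (hg : IsFractionHom g) (L : Type v)
    [Field L] [Algebra k L] [FiniteDimensional k L] :
    Nonempty (PlaceSystem ((algebraMap k L).comp g) (finrank k L)) := by
  let := g.toAlgebra
  let := ((algebraMap k L).comp g).toAlgebra
  have : IsFractionRing F[X] k := hg
  have : IsScalarTower F[X] k L := .of_algebraMap_eq fun _ => rfl
  exact FunctionFieldHeight.nonempty_placeSystem k L

end IsFractionHom

section Inversion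

variable {F : Type*} [Field F]

variable (F) in
/-- The homomorphism from `F[X]` to `F(X)` sending `X` to `X⁻¹`. It provides the places that
`F[X]` misses, namely those above infinity. -/
noncomputable def invXHom : F[X] →+* RatFunc F :=
  eval₂RingHom RatFunc.C RatFunc.X⁻¹

theorem invXHom_reflect_mul {n : ℕ} {p : F[X]} (hp : p.natDegree ≤ n) :
    invXHom F (reflect n p) * RatFunc.X ^ n = algebraMap F[X] (RatFunc F) p := by
  let : Invertible (RatFunc.X : RatFunc F) := invertibleOfNonzero RatFunc.X_ne_zero
  rw [invXHom, coe_eval₂RingHom, ← invOf_eq_inv, eval₂_reflect_mul_pow _ _ n p hp,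
    ← RatFunc.aeval_X_left_eq_algebraMap, aeval_def, RatFunc.algebraMap_eq_C]

theorem invXHom_mul {n : ℕ} {p : F[X]} (hp : p.natDegree ≤ n) :
    invXHom F p * RatFunc.X ^ n = algebraMap F[X] (RatFunc F) (reflect n p) := by
  have hreflect : (reflect n p).natDegree ≤ n := natDegree_reflect_le.trans (max_le le_rfl hp)
  simpa only [reflect_reflect] using invXHom_reflect_mul hreflect

theorem invXHom_injective : Function.Injective (invXHom F) := by
  rw [injective_iff_map_eq_zero]
  intro p hp
  have hreflect := invXHom_mul p.natDegree.le_refl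
  rw [hp, zero_mul] at hreflect
  simpa using hreflect.symm

theorem exists_eq_invXHom_div_invXHom (z : RatFunc F) :
    ∃ p r, z = invXHom F p / invXHom F r := by
  let n := max z.num.natDegree z.denom.natDegree
  refine ⟨reflect n z.num, reflect n z.denom, ?_⟩
  have hX : (RatFunc.X : RatFunc F) ^ n ≠ 0 := pow_ne_zero n RatFunc.X_ne_zero
  rw [← mul_div_mul_right _ _ hX, invXHom_reflect_mul (le_max_left _ _),
    invXHom_reflect_mul (le_max_right _ _), RatFunc.num_div_denom]

theorem isFractionHom_invXHom : IsFractionHom (invXHom F) :=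
  .of_injective invXHom_injective exists_eq_invXHom_div_invXHom

theorem natDegree_eq_zero_of_algebraMap_eq_invXHom {p r : F[X]}
    (h : algebraMap F[X] (RatFunc F) p = invXHom F r) : p.natDegree = 0 := by
  rcases eq_or_ne p 0 with rfl | hp
  · exact natDegree_zero
  have hmul : p * X ^ r.natDegree = reflect r.natDegree r := by
    apply RatFunc.algebraMap_injective F
    rw [← invXHom_mul le_rfl, ← h, map_mul, map_pow, RatFunc.algebraMap_X]
  have hdeg : (p * X ^ r.natDegree).natDegree ≤ r.natDegree :=
    hmul ▸ natDegree_reflect_le.trans (max_le le_rfl le_rfl)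
  rw [natDegree_mul_X_pow _ hp] at hdeg
  lia

end Inversion

section Constants

variable {F : Type*} [Field F] {K : Type*} [Field K]

theorem card_le_of_minpoly_mem_lifts [Finite F] {k : Type*} [Field k] [Algebra F k] [Algebra k K]
    [FiniteDimensional k K] {s : Finset K}
    (hs : ∀ x ∈ s, minpoly k x ∈ lifts (algebraMap F k)) :
    s.card ≤ finrank k K * Nat.card F ^ (finrank k K + 1) := by
  classical
  choose! p hp using fun x hx => (mem_lifts _).1 (hs x hx)
  have hdeg (y) (hy : y ∈ s.image p) : y.natDegree ≤ finrank k K := by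
    obtain ⟨x, hx, rfl⟩ := Finset.mem_image.1 hy
    rw [← natDegree_map (algebraMap F k), hp x hx]
    exact minpoly.natDegree_le x
  have hfib (y) (hy : y ∈ s.image p) : (s.filter (p · = y)).card ≤ finrank k K := by
    obtain ⟨x, hx, rfl⟩ := Finset.mem_image.1 hy
    have hsub : s.filter (p · = p x) ⊆ ((minpoly k x).aroots K).toFinset := fun z hz => by
      obtain ⟨hzs, hzx⟩ := Finset.mem_filter.1 hz
      rw [Multiset.mem_toFinset, mem_aroots, ← hp x hx, ← hzx, hp z hzs]
      exact ⟨minpoly.ne_zero (.of_finite k z), minpoly.aeval k z⟩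
    calc (s.filter (p · = p x)).card ≤ ((minpoly k x).aroots K).toFinset.card :=
          Finset.card_le_card hsub
      _ ≤ ((minpoly k x).aroots K).card := Multiset.toFinset_card_le _
      _ ≤ (minpoly k x).natDegree := (card_roots' _).trans natDegree_map_le
      _ ≤ finrank k K := minpoly.natDegree_le x
  exact (Finset.card_le_mul_card_image s _ hfib).trans <|
    Nat.mul_le_mul_left _ (card_le_card_pow_of_natDegree_le hdeg)

variable [Algebra (RatFunc F) K]

variable (F K) in
/-- The inclusion of `F[X]` in an extension of `F(X)`. -/
noncomputable def polyHom : F[X] →+* K :=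
  (algebraMap (RatFunc F) K).comp (algebraMap F[X] (RatFunc F))

variable (F K) in
/-- The homomorphism from `F[X]` to an extension of `F(X)` sending `X` to `X⁻¹`. -/
noncomputable def polyInvHom : F[X] →+* K :=
  (algebraMap (RatFunc F) K).comp (invXHom F)

theorem minpoly_mem_lifts_of_isIntegralElem {x : K} (hx : (polyHom F K).IsIntegralElem x)
    (hx' : (polyInvHom F K).IsIntegralElem x) :
    minpoly (RatFunc F) x ∈ lifts (algebraMap F (RatFunc F)) := by
  rw [lifts_iff_coeff_lifts]
  intro i
  obtain ⟨p, hp⟩ := (lifts_iff_coeff_lifts _).1 (isFractionHom_algebraMap.minpoly_mem_lifts hx) i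
  obtain ⟨r, hr⟩ := (lifts_iff_coeff_lifts _).1 (isFractionHom_invXHom.minpoly_mem_lifts hx') i
  obtain ⟨c, rfl⟩ :=
    natDegree_eq_zero.1 (natDegree_eq_zero_of_algebraMap_eq_invXHom (hp.trans hr.symm))
  exact ⟨c, by rw [← hp, RatFunc.algebraMap_C, RatFunc.algebraMap_eq_C]⟩

theorem card_le_of_isIntegralElem [Finite F] [FiniteDimensional (RatFunc F) K] {s : Finset K}
    (hs : ∀ x ∈ s, (polyHom F K).IsIntegralElem x)
    (hs' : ∀ x ∈ s, (polyInvHom F K).IsIntegralElem x) :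
    s.card ≤ finrank (RatFunc F) K * Nat.card F ^ (finrank (RatFunc F) K + 1) :=
  card_le_of_minpoly_mem_lifts fun x hx =>
    minpoly_mem_lifts_of_isIntegralElem (hs x hx) (hs' x hx)

end Constants

section Heights

theorem hasDenominator_of_eval₂_eq_zero {F L : Type*} [Field F] [Field L] {g : F[X] →+* L}
    {x : Lˣ} {n : ℕ} {P : F[X][X]} (hP : P ≠ 0) (hdeg : ∀ i, (P.coeff i).natDegree ≤ n)
    (hx : P.eval₂ g x = 0) : HasDenominator g (2 * n) x := by
  have hlead : g.IsIntegralElem (g P.leadingCoeff * x) := g.isIntegralElem_leadingCoeff_mul P x hx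
  have htrail : g.IsIntegralElem (g P.trailingCoeff * ↑x⁻¹) := by
    have hrev := (eval₂_reverse_eq_zero_iff g (x : L) P).2 hx
    rw [← reverse_leadingCoeff]
    refine g.isIntegralElem_leadingCoeff_mul P.reverse _ ?_
    rwa [invOf_units] at hrev
  refine ⟨P.leadingCoeff * P.trailingCoeff, mul_ne_zero (leadingCoeff_ne_zero.2 hP)
    (trailingCoeff_nonzero_iff_nonzero.2 hP), ?_, ?_, ?_⟩
  · exact two_mul n ▸ natDegree_mul_le_of_le (hdeg _) (hdeg _)
  · rw [map_mul, mul_right_comm, mul_comm]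
    exact g.isIntegralElem_map.mul g hlead
  · rw [map_mul, mul_assoc]
    exact g.isIntegralElem_map.mul g htrail

variable {F : Type*} [Field F] {K : Type*} [Field K] [Algebra (RatFunc F) K]

theorem exists_reflect_coeff {n : ℕ} {P : F[X][X]} (hdeg : ∀ i, (P.coeff i).natDegree ≤ n) :
    ∃ Q : F[X][X], (∀ i, Q.coeff i = reflect n (P.coeff i)) ∧
      ∀ x : K, Q.eval₂ (polyInvHom F K) x * algebraMap (RatFunc F) K (RatFunc.X ^ n) =
        P.eval₂ (polyHom F K) x := by
  refine ⟨∑ i ∈ P.support, monomial i (reflect n (P.coeff i)), fun i => ?_, fun x => ?_⟩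
  · simp only [finsetSum_coeff, coeff_monomial, Finset.sum_ite_eq']
    split_ifs with hi
    · rfl
    · rw [notMem_support_iff.1 hi, reflect_zero]
  · rw [eval₂_finsetSum, Finset.sum_mul, eval₂_eq_sum, Polynomial.sum]
    refine Finset.sum_congr rfl fun i _ => ?_
    rw [eval₂_monomial, mul_right_comm, polyHom, RingHom.comp_apply,
      ← invXHom_reflect_mul (hdeg i), map_mul, polyInvHom, RingHom.comp_apply]

variable (F) in
/-- `x` has a denominator of degree at most `n` both over `F[X]` and over `F[X⁻¹]`. -/
def HasDenominators (n : ℕ) (x : Kˣ) : Prop :=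
  HasDenominator (polyHom F K) n x ∧ HasDenominator (polyInvHom F K) n x

theorem HasDenominators.mono {m n : ℕ} {x : Kˣ} (hx : HasDenominators F m x) (hmn : m ≤ n) :
    HasDenominators F n x :=
  ⟨hx.1.mono hmn, hx.2.mono hmn⟩

theorem hasDenominators_one : HasDenominators F 0 (1 : Kˣ) :=
  ⟨hasDenominator_one _, hasDenominator_one _⟩

theorem HasDenominators.mul {m n : ℕ} {x y : Kˣ} (hx : HasDenominators F m x)
    (hy : HasDenominators F n y) : HasDenominators F (m + n) (x * y) :=
  ⟨hx.1.mul hy.1, hx.2.mul hy.2⟩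

theorem exists_eval₂_eq_zero_of_height_le [FiniteDimensional (RatFunc F) K] {x : K} {n : ℕ}
    (hx : height F x ≤ n) :
    ∃ P : F[X][X], P ≠ 0 ∧ (∀ i, (P.coeff i).natDegree ≤ n) ∧ P.eval₂ (polyHom F K) x = 0 := by
  obtain ⟨P, hP⟩ := exists_isMinpoly (F := F) x
  refine ⟨P, hP.1.ne_zero, fun i => ?_, ?_⟩
  · rcases eq_or_ne (P.coeff i) 0 with hi | hi
    · simp only [hi, natDegree_zero, zero_le]
    · rw [height_eq hP] at hx
      exact (Finset.le_sup (f := fun i => (P.coeff i).natDegree) (mem_support_iff.2 hi)).trans hx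
  · rw [polyHom, ← eval₂_map, ← aeval_def]
    exact hP.2

theorem hasDenominators_of_height_le [FiniteDimensional (RatFunc F) K] {x : Kˣ} {n : ℕ}
    (hx : height F (x : K) ≤ n) : HasDenominators F (2 * n) x := by
  obtain ⟨P, hP, hdeg, hPx⟩ := exists_eval₂_eq_zero_of_height_le hx
  obtain ⟨Q, hQ, heval⟩ := exists_reflect_coeff (K := K) hdeg
  refine ⟨hasDenominator_of_eval₂_eq_zero hP hdeg hPx,
    hasDenominator_of_eval₂_eq_zero (P := Q) ?_ (fun i => ?_) ?_⟩
  · rintro rfl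
    refine hP (ext fun i => ?_)
    simpa using (hQ i).symm
  · exact hQ i ▸ natDegree_reflect_le.trans (max_le le_rfl (hdeg i))
  · have hX : algebraMap (RatFunc F) K (RatFunc.X ^ n) ≠ 0 :=
      (_root_.map_ne_zero _).2 (pow_ne_zero n RatFunc.X_ne_zero)
    exact (mul_eq_zero.1 ((heval x).trans hPx)).resolve_right hX

end Heights

section Threshold

theorem log_sq_le_sixteen_mul_sqrt {x : ℝ} (hx : 1 ≤ x) : Real.log x ^ 2 ≤ 16 * √x := by
  have hlog : Real.log x = 4 * Real.log √√x := by
    rw [Real.log_sqrt (Real.sqrt_nonneg x), Real.log_sqrt (zero_le_one.trans hx)]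
    ring
  calc Real.log x ^ 2 = 16 * Real.log √√x ^ 2 := by rw [hlog]; ring
    _ ≤ 16 * √√x ^ 2 := by
        gcongr
        · exact Real.log_nonneg (Real.one_le_sqrt.2 (Real.one_le_sqrt.2 hx))
        · exact Real.log_le_self (Real.sqrt_nonneg _)
    _ = 16 * √x := by rw [Real.sq_sqrt (Real.sqrt_nonneg x)]

theorem sqrt_mul_log_le {x : ℝ} (hx : 1 < x) : √x * Real.log x ≤ 16 * (x / Real.log x) := by
  rw [← mul_div_assoc, le_div_iff₀ (Real.log_pos hx)]
  calc √x * Real.log x * Real.log x = √x * Real.log x ^ 2 := by ring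
    _ ≤ √x * (16 * √x) := by gcongr; exact log_sq_le_sixteen_mul_sqrt hx.le
    _ = 16 * x := by rw [mul_left_comm, Real.mul_self_sqrt (by linarith)]

theorem exists_pow_le_sqrt_and_log_le (q : ℕ) {x : ℝ} (hx : 1 ≤ x) :
    ∃ m : ℕ, (q : ℝ) ^ m ≤ √x ∧ Real.log x ≤ 2 * (q + 1) * (m + 1) := by
  have hlog := Real.log_nonneg hx
  have hc : (0 : ℝ) < 2 * (q + 1) := by positivity
  refine ⟨⌊Real.log x / (2 * (q + 1))⌋₊, ?_, ?_⟩
  · have hfloor := (le_div_iff₀ hc).1 (Nat.floor_le (div_nonneg hlog hc.le))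
    set m := ⌊Real.log x / (2 * (q + 1))⌋₊
    refine Real.le_sqrt_of_sq_le ?_
    calc ((q : ℝ) ^ m) ^ 2 ≤ (Real.exp (q + 1) ^ m) ^ 2 := by
          gcongr
          linarith [Real.add_one_le_exp ((q : ℝ) + 1)]
      _ = Real.exp (m * (2 * (q + 1))) := by
          rw [← Real.exp_nat_mul, ← Real.exp_nat_mul]
          push_cast
          ring_nf
      _ ≤ x := (Real.le_log_iff_exp_le (by linarith)).1 hfloor
  · rw [← div_le_iff₀' hc]
    exact (Nat.lt_floor_add_one _).le

theorem one_le_log_add_two {h : ℝ} (hh : 1 ≤ h) : 1 ≤ Real.log (h + 2) := by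
  rw [Real.le_log_iff_exp_le (by linarith)]
  linarith [Real.exp_one_lt_d9]

theorem log_two_mul_add_one_le {k M : ℕ} {h : ℝ} (hh : 1 ≤ h) (hM : M ≤ k * h) :
    Real.log (2 * M + 1) ≤ (2 * k + 1) * Real.log (h + 2) := by
  have hL := one_le_log_add_two hh
  calc Real.log (2 * M + 1) ≤ Real.log ((2 * k + 1) * (h + 2)) :=
        Real.log_le_log (by positivity) (by nlinarith)
    _ = Real.log (2 * k + 1) + Real.log (h + 2) := Real.log_mul (by positivity) (by linarith)
    _ ≤ 2 * k + Real.log (h + 2) := by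
        linarith [Real.log_le_sub_one_of_pos (by positivity : (0 : ℝ) < 2 * k + 1)]
    _ ≤ (2 * k + 1) * Real.log (h + 2) := by nlinarith [Nat.cast_nonneg (α := ℝ) k]

/- With `q ^ m` about `√h`, both the number of places of degree at most `m` times `log h`, and the
number `h / m` of places of larger degree at which an element can be nontrivial, are
`O(h / log h)`. -/
theorem exists_pow_mul_pow_le_exp (q D k : ℕ) :
    ∃ C : ℝ, 0 < C ∧ ∀ h : ℝ, 1 ≤ h → ∃ m : ℕ, ∀ M : ℕ, M ≤ k * h →
      (2 * M + 1 : ℝ) ^ (D * q ^ (m + 1)) * 3 ^ (M / (m + 1)) ≤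
        Real.exp (C * (h / Real.log (h + 2))) := by
  refine ⟨48 * D * q * (2 * k + 1) + 4 * k * (q + 1) + 1, by positivity, fun h hh => ?_⟩
  obtain ⟨m, hqm, hmlog⟩ := exists_pow_le_sqrt_and_log_le q (by linarith : 1 ≤ h + 2)
  refine ⟨m, fun M hM => ?_⟩
  have hL := one_le_log_add_two hh
  set L := Real.log (h + 2)
  have hgauge : 0 ≤ h / L := by positivity
  have hsmall : (D * q ^ (m + 1) : ℕ) * Real.log (2 * M + 1) ≤
      48 * D * q * (2 * k + 1) * (h / L) := by
    calc (D * q ^ (m + 1) : ℕ) * Real.log (2 * M + 1)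
        ≤ (D * q ^ (m + 1) : ℕ) * ((2 * k + 1) * L) := by gcongr; exact log_two_mul_add_one_le hh hM
      _ = D * q * (2 * k + 1) * (q ^ m * L) := by push_cast; ring
      _ ≤ D * q * (2 * k + 1) * (√(h + 2) * L) := by gcongr
      _ ≤ D * q * (2 * k + 1) * (16 * ((h + 2) / L)) := by
          gcongr ?_ * ?_
          exact sqrt_mul_log_le (by linarith)
      _ ≤ D * q * (2 * k + 1) * (16 * (3 * h / L)) := by gcongr; linarith
      _ = 48 * D * q * (2 * k + 1) * (h / L) := by ring
  have hlarge : (M / (m + 1) : ℕ) * Real.log 3 ≤ 4 * k * (q + 1) * (h / L) := by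
    have hlog : Real.log 3 ≤ 2 := by linarith [Real.log_le_sub_one_of_pos (zero_lt_three' ℝ)]
    calc (M / (m + 1) : ℕ) * Real.log 3 ≤ k * h / (m + 1) * 2 := by
          gcongr
          exact Nat.cast_div_le.trans (by push_cast; gcongr)
      _ ≤ k * h / (L / (2 * (q + 1))) * 2 := by
          gcongr
          exact (div_le_iff₀' (by positivity)).2 hmlog
      _ = 4 * k * (q + 1) * (h / L) := by field_simp; ring
  rw [← Real.exp_log (by positivity : (0 : ℝ) < 2 * M + 1),
    ← Real.exp_log (zero_lt_three' ℝ), ← Real.exp_nat_mul, ← Real.exp_nat_mul, ← Real.exp_add]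
  exact Real.exp_le_exp.2 (by linarith)

theorem one_half_le_div_log_add_two {h : ℝ} (hh : 1 ≤ h) : 1 / 2 ≤ h / Real.log (h + 2) := by
  rw [le_div_iff₀ (zero_lt_one.trans_le (one_le_log_add_two hh))]
  linarith [Real.log_le_sub_one_of_pos (by linarith : 0 < h + 2)]

theorem div_log_add_two_le_div_sqrt_log {h : ℝ} (hh : 1 < h) :
    h / Real.log (h + 2) ≤ h / √(Real.log h) := by
  have hL := one_le_log_add_two hh.le
  refine div_le_div_of_nonneg_left (by linarith) (Real.sqrt_pos.2 (Real.log_pos hh)) ?_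
  rw [Real.sqrt_le_left (by linarith)]
  calc Real.log h ≤ Real.log (h + 2) := Real.log_le_log (by linarith) (by linarith)
    _ ≤ Real.log (h + 2) ^ 2 := le_self_pow₀ hL two_ne_zero

theorem le_exp_two_mul_mul {r t : ℝ} (hr : 0 ≤ r) (ht : 1 / 2 ≤ t) : r ≤ Real.exp (2 * r * t) :=
  calc r ≤ Real.exp r := (lt_add_one r).le.trans (Real.add_one_le_exp r)
    _ ≤ Real.exp (2 * r * t) := Real.exp_le_exp.2 (by nlinarith)

theorem exp_neg_mul_lt_of_le_exp_mul {c t x y : ℝ} (hx : 0 < x) (ht : 0 < t)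
    (h : x ≤ Real.exp (c * t) * y) : Real.exp (-((c + 1) * t)) * x < y :=
  calc Real.exp (-((c + 1) * t)) * x < Real.exp (-(c * t)) * x := by gcongr; linarith
    _ ≤ Real.exp (-(c * t)) * (Real.exp (c * t) * y) := by gcongr
    _ = y := by rw [← mul_assoc, ← Real.exp_add, neg_add_cancel, Real.exp_zero, one_mul]

theorem exp_neg_mul_div_sqrt_log_mul_le {C h x : ℝ} (hC : 0 < C) (hh : 1 < h) (hx : 0 ≤ x) :
    Real.exp (-(C * (h / √(Real.log h)))) * x ≤ Real.exp (-(C * (h / Real.log (h + 2)))) * x :=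
  mul_le_mul_of_nonneg_right (Real.exp_le_exp.2 (neg_le_neg
    (mul_le_mul_of_nonneg_left (div_log_add_two_le_div_sqrt_log hh) hC.le))) hx

end Threshold

section ProductSets

open ProductSet

theorem card_mul_card_le_of_hasDenominators {F : Type*} [Field F] [Finite F] {K : Type*} [Field K]
    [DecidableEq Kˣ] [Algebra (RatFunc F) K] [FiniteDimensional (RatFunc F) K] {d m n : ℕ}
    (hd : finrank (RatFunc F) K = d) {A B : Finset Kˣ}
    (hAB : ∀ x ∈ A ∪ B, HasDenominators F n x) :
    A.card * B.card ≤ (d * Nat.card F ^ (d + 1)) ^ 2 *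
      ((2 * (2 * d * n) + 1) ^ (2 * d * Nat.card F ^ (m + 1)) * 3 ^ (2 * d * n / (m + 1))) ^ 4 *
        (A * B).card := by
  subst hd
  obtain ⟨P⟩ := isFractionHom_algebraMap.nonempty_placeSystem (F := F) K
  obtain ⟨Q⟩ := isFractionHom_invXHom.nonempty_placeSystem (F := F) K
  refine card_mul_card_le_of_monoidHom (Sum.elim P.ord Q.ord) (fun C hC => ?_) fun x hx s => ?_
  · rw [← C.card_map ⟨Units.val, Units.val_injective⟩]
    refine card_le_of_isIntegralElem (F := F) ?_ ?_ <;> simp only [Finset.forall_mem_map]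
    · exact fun x hx => P.isIntegralElem_of_ord_eq_one fun v => hC x hx (.inl v)
    · exact fun x hx => Q.isIntegralElem_of_ord_eq_one fun v => hC x hx (.inr v)
  · refine prod_two_mul_add_one_le (deg := Sum.elim P.deg Q.deg) (fun i _ => ?_) ?_ ?_
    · cases i with
      | inl v => exact P.deg_pos v
      | inr v => exact Q.deg_pos v
    · rw [← s.toLeft_disjSum_toRight, Finset.sum_disjSum, mul_assoc, two_mul]
      exact add_le_add (P.sum_le (hAB x hx).1 _) (Q.sum_le (hAB x hx).2 _)
    · rw [← (s.filter _).toLeft_disjSum_toRight, Finset.card_disjSum, mul_assoc, two_mul]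
      refine add_le_add (P.card_le fun v hv => ?_) (Q.card_le fun v hv => ?_)
      · exact (Finset.mem_filter.1 (Finset.mem_toLeft.1 hv)).2
      · exact (Finset.mem_filter.1 (Finset.mem_toRight.1 hv)).2

theorem exists_card_mul_card_le_of_hasDenominators (q d k : ℕ) :
    ∃ C : ℝ, 0 < C ∧
      ∀ (F : Type u) [Field F] [Finite F] (K : Type v) [Field K] [DecidableEq Kˣ]
        [Algebra (RatFunc F) K] [FiniteDimensional (RatFunc F) K],
        Nat.card F = q → finrank (RatFunc F) K = d →
        ∀ h : ℝ, 1 ≤ h → ∀ n : ℕ, n ≤ k * h → ∀ A B : Finset Kˣ,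
          (∀ x ∈ A ∪ B, HasDenominators F n x) →
          (A.card * B.card : ℝ) ≤
            Real.exp (C * (h / Real.log (h + 2))) * (A * B).card := by
  obtain ⟨C, hC, hbound⟩ := exists_pow_mul_pow_le_exp q (2 * d) (2 * d * k)
  set R : ℕ := (d * q ^ (d + 1)) ^ 2
  refine ⟨2 * R + 4 * C, by positivity, ?_⟩
  rintro F _ _ K _ _ _ _ rfl hd h hh n hn A B hAB
  obtain ⟨m, hm⟩ := hbound h hh
  have hn' : (2 * d * n : ℕ) ≤ (2 * d * k : ℕ) * h := by
    push_cast
    rw [mul_assoc _ (k : ℝ)]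
    gcongr
  set E : ℝ := Real.exp (C * (h / Real.log (h + 2))) with hE
  calc (A.card * B.card : ℝ) ≤ R * ((2 * (2 * d * n : ℕ) + 1) ^ (2 * d * Nat.card F ^ (m + 1)) *
        3 ^ (2 * d * n / (m + 1))) ^ 4 * (A * B).card :=
        mod_cast card_mul_card_le_of_hasDenominators hd hAB
    _ ≤ Real.exp (2 * R * (h / Real.log (h + 2))) * E ^ 4 * (A * B).card := by
        gcongr
        · exact le_exp_two_mul_mul R.cast_nonneg (one_half_le_div_log_add_two hh)
        · exact hm _ hn'
    _ = Real.exp ((2 * R + 4 * C) * (h / Real.log (h + 2))) * (A * B).card := by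
        rw [hE, ← Real.exp_nat_mul, ← Real.exp_add]
        push_cast
        ring_nf

theorem hasDenominators_of_mem_pow {F K : Type*} [Field F] [Field K] [DecidableEq Kˣ]
    [Algebra (RatFunc F) K] {n : ℕ} {A : Finset Kˣ} (hA : ∀ x ∈ A, HasDenominators F n x) {j : ℕ} :
    ∀ x ∈ A ^ j, HasDenominators F (j * n) x := by
  induction j with
  | zero =>
    intro x hx
    rw [pow_zero, Finset.mem_one] at hx
    rw [hx, zero_mul]
    exact hasDenominators_one
  | succ j ih =>
    intro x hx
    rw [pow_succ] at hx
    obtain ⟨y, hy, z, hz, rfl⟩ := Finset.mem_mul.1 hx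
    rw [Nat.succ_mul]
    exact (ih y hy).mul (hA z hz)

theorem exists_card_pow_le_of_hasDenominators (q d k ν : ℕ) :
    ∃ C : ℝ, 0 < C ∧
      ∀ (F : Type u) [Field F] [Finite F] (K : Type v) [Field K] [DecidableEq Kˣ]
        [Algebra (RatFunc F) K] [FiniteDimensional (RatFunc F) K],
        Nat.card F = q → finrank (RatFunc F) K = d →
        ∀ h : ℝ, 1 ≤ h → ∀ n : ℕ, n ≤ k * h → ∀ A : Finset Kˣ,
          (∀ x ∈ A, HasDenominators F n x) →
          (A.card : ℝ) ^ ν ≤ Real.exp (C * (h / Real.log (h + 2))) * (A ^ ν).card := by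
  obtain ⟨C, hC, hmul⟩ := exists_card_mul_card_le_of_hasDenominators.{u, v} q d (ν * k)
  refine ⟨ν * C + 1, by positivity, ?_⟩
  intro F _ _ K _ _ _ _ hq hd h hh n hn A hA
  have hgauge := one_half_le_div_log_add_two hh
  set E : ℝ := Real.exp (C * (h / Real.log (h + 2))) with hE
  have hstep (j : ℕ) (hj : j < ν) : ((A ^ j).card * A.card : ℝ) ≤ E * (A ^ (j + 1)).card := by
    have hνn : (ν * n : ℕ) ≤ (ν * k : ℕ) * h := by
      push_cast
      rw [mul_assoc]
      gcongr
    rw [pow_succ]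
    refine hmul F K hq hd h hh (ν * n) hνn (A ^ j) A fun x hx => ?_
    rcases Finset.mem_union.1 hx with hx | hx
    · exact (hasDenominators_of_mem_pow hA x hx).mono (Nat.mul_le_mul_right n hj.le)
    · exact (hA x hx).mono (Nat.le_mul_of_pos_left n (Nat.zero_lt_of_lt hj))
  calc (A.card : ℝ) ^ ν ≤ E ^ ν * (A ^ ν).card :=
        card_pow_le_of_card_pow_mul_card_le (Real.exp_pos _).le hstep
    _ = Real.exp (ν * C * (h / Real.log (h + 2))) * (A ^ ν).card := by
        rw [hE, ← Real.exp_nat_mul, mul_assoc]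
    _ ≤ Real.exp ((ν * C + 1) * (h / Real.log (h + 2))) * (A ^ ν).card := by
        gcongr
        linarith

end ProductSets

section UnitPart

variable {K : Type*} [Field K] {A B : Finset K}

/-- The nonzero elements of a finite set, as a finite set of units. -/
noncomputable def unitPart (A : Finset K) : Finset Kˣ :=
  A.preimage Units.val Units.val_injective.injOn

theorem mem_unitPart {x : Kˣ} : x ∈ unitPart A ↔ (x : K) ∈ A :=
  Finset.mem_preimage

theorem hasDenominators_of_mem_unitPart {F : Type*} [Field F] [Algebra (RatFunc F) K]
    [FiniteDimensional (RatFunc F) K] {h : ℝ} (hA : ∀ a ∈ A, height F a ≤ h) :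
    ∀ x ∈ unitPart A, HasDenominators F (2 * ⌊h⌋₊) x :=
  fun x hx => hasDenominators_of_height_le (Nat.le_floor (hA x (mem_unitPart.1 hx)))

theorem image_coe_unitPart [DecidableEq K] : (unitPart A).image (Units.coeHom K) = A.erase 0 := by
  ext x
  rw [Finset.mem_image, Finset.mem_erase]
  constructor
  · rintro ⟨y, hy, rfl⟩
    exact ⟨y.ne_zero, mem_unitPart.1 hy⟩
  · rintro ⟨hx, hxA⟩
    exact ⟨Units.mk0 x hx, mem_unitPart.2 hxA, rfl⟩

theorem card_unitPart [DecidableEq K] : (unitPart A).card = (A.erase 0).card := by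
  rw [← image_coe_unitPart]
  exact (Finset.card_image_of_injective _ Units.val_injective).symm

theorem card_le_two_mul_card_unitPart (hA : ∃ a ∈ A, a ≠ 0) : A.card ≤ 2 * (unitPart A).card := by
  classical
  obtain ⟨a, haA, ha⟩ := hA
  have hpos : 0 < (A.erase 0).card := Finset.card_pos.2 ⟨a, Finset.mem_erase.2 ⟨ha, haA⟩⟩
  have herase := A.pred_card_le_card_erase (a := 0)
  rw [card_unitPart]
  lia

variable [DecidableEq K]

theorem card_unitPart_mul_le : (unitPart A * unitPart B).card ≤ (A * B).card := by
  have hinj : Function.Injective (Units.coeHom K) := Units.val_injective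
  rw [← Finset.card_image_of_injective _ hinj, Finset.image_mul, image_coe_unitPart,
    image_coe_unitPart]
  exact Finset.card_le_card (Finset.mul_subset_mul (A.erase_subset 0) (B.erase_subset 0))

theorem card_unitPart_pow_le {ν : ℕ} : (unitPart A ^ ν).card ≤ (A ^ ν).card := by
  have hinj : Function.Injective (Units.coeHom K) := Units.val_injective
  rw [← Finset.card_image_of_injective _ hinj, Finset.image_pow, image_coe_unitPart]
  exact Finset.card_le_card (Finset.pow_subset_pow_left (A.erase_subset 0))

end UnitPart

section Main

theorem exists_card_mul_card_le (q d : ℕ) :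
    ∃ C : ℝ, 0 < C ∧
      ∀ (F : Type u) [Field F] [Finite F] (K : Type v) [Field K] [DecidableEq K]
        [Algebra (RatFunc F) K] [FiniteDimensional (RatFunc F) K],
        Nat.card F = q → finrank (RatFunc F) K = d →
        ∀ h : ℝ, 1 ≤ h → ∀ A B : Finset K,
          (∀ a ∈ A, height F a ≤ h) → (∀ b ∈ B, height F b ≤ h) →
          (∃ a ∈ A, a ≠ 0) → (∃ b ∈ B, b ≠ 0) →
          (A.card * B.card : ℝ) ≤ Real.exp (C * (h / Real.log (h + 2))) * (A * B).card := by
  obtain ⟨C, hC, hmul⟩ := exists_card_mul_card_le_of_hasDenominators.{u, v} q d 2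
  refine ⟨8 + C, by positivity, ?_⟩
  intro F _ _ K _ _ _ _ hq hd h hh A B hA hB hA0 hB0
  have hfloor : (2 * ⌊h⌋₊ : ℕ) ≤ (2 : ℕ) * h := by
    push_cast
    gcongr
    exact Nat.floor_le (by linarith)
  have hunits := hmul F K hq hd h hh _ hfloor (unitPart A) (unitPart B) fun x hx =>
    (Finset.mem_union.1 hx).elim (hasDenominators_of_mem_unitPart hA x)
      (hasDenominators_of_mem_unitPart hB x)
  set t := h / Real.log (h + 2)
  have hfour : (4 : ℝ) ≤ Real.exp (8 * t) := by
    convert le_exp_two_mul_mul zero_le_four (one_half_le_div_log_add_two hh) using 3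
    norm_num
  calc (A.card * B.card : ℝ) ≤ (2 * (unitPart A).card) * (2 * (unitPart B).card) := by
        gcongr
        · exact mod_cast card_le_two_mul_card_unitPart hA0
        · exact mod_cast card_le_two_mul_card_unitPart hB0
    _ = 4 * ((unitPart A).card * (unitPart B).card) := by ring
    _ ≤ Real.exp (8 * t) * (Real.exp (C * t) * (unitPart A * unitPart B).card) := by gcongr
    _ ≤ Real.exp (8 * t) * (Real.exp (C * t) * (A * B).card) := by
        gcongr
        exact card_unitPart_mul_le
    _ = Real.exp ((8 + C) * t) * (A * B).card := by rw [← mul_assoc, ← Real.exp_add, add_mul]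

theorem exists_card_pow_le (q d ν : ℕ) :
    ∃ C : ℝ, 0 < C ∧
      ∀ (F : Type u) [Field F] [Finite F] (K : Type v) [Field K] [DecidableEq K]
        [Algebra (RatFunc F) K] [FiniteDimensional (RatFunc F) K],
        Nat.card F = q → finrank (RatFunc F) K = d →
        ∀ h : ℝ, 1 ≤ h → ∀ A : Finset K, A.Nonempty → (∀ a ∈ A, height F a ≤ h) →
          (A.card : ℝ) ^ ν ≤ Real.exp (C * (h / Real.log (h + 2))) * (A ^ ν).card := by
  obtain ⟨C, hC, hpow⟩ := exists_card_pow_le_of_hasDenominators.{u, v} q d 2 ν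
  refine ⟨2 * 2 ^ ν + C, by positivity, ?_⟩
  intro F _ _ K _ _ _ _ hq hd h hh A hAne hA
  have hgauge := one_half_le_div_log_add_two hh
  set t := h / Real.log (h + 2)
  by_cases hA0 : ∃ a ∈ A, a ≠ 0
  · have hfloor : (2 * ⌊h⌋₊ : ℕ) ≤ (2 : ℕ) * h := by
      push_cast
      gcongr
      exact Nat.floor_le (by linarith)
    have hunits := hpow F K hq hd h hh _ hfloor (unitPart A) (hasDenominators_of_mem_unitPart hA)
    have htwo : (2 : ℝ) ^ ν ≤ Real.exp (2 * 2 ^ ν * t) := le_exp_two_mul_mul (by positivity) hgauge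
    calc (A.card : ℝ) ^ ν ≤ (2 * (unitPart A).card) ^ ν := by
          gcongr
          exact mod_cast card_le_two_mul_card_unitPart hA0
      _ = 2 ^ ν * (unitPart A).card ^ ν := mul_pow _ _ _
      _ ≤ Real.exp (2 * 2 ^ ν * t) * (Real.exp (C * t) * (unitPart A ^ ν).card) := by gcongr
      _ ≤ Real.exp (2 * 2 ^ ν * t) * (Real.exp (C * t) * (A ^ ν).card) := by
          gcongr
          exact card_unitPart_pow_le
      _ = Real.exp ((2 * 2 ^ ν + C) * t) * (A ^ ν).card := by
          rw [← mul_assoc, ← Real.exp_add, add_mul]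
  · push Not at hA0
    have hcard : A.card ≤ 1 := Finset.card_le_one.2 fun a ha b hb => by rw [hA0 a ha, hA0 b hb]
    have hexp : 1 ≤ Real.exp ((2 * 2 ^ ν + C) * t) := Real.one_le_exp (by positivity)
    calc (A.card : ℝ) ^ ν ≤ 1 := pow_le_one₀ (Nat.cast_nonneg _) (mod_cast hcard)
      _ ≤ Real.exp ((2 * 2 ^ ν + C) * t) * (A ^ ν).card :=
          one_le_mul_of_one_le_of_one_le hexp (mod_cast Finset.card_pos.2 hAne.pow)

end Main

end FunctionFieldHeight

open FunctionFieldHeight in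
theorem mainTheorem3_general (q d : ℕ) :
    (∃ C : ℝ, 0 < C ∧
      ∀ (F : Type u) [Field F] [Finite F] (K : Type v) [Field K] [DecidableEq K]
        [Algebra (RatFunc F) K] [FiniteDimensional (RatFunc F) K],
        Nat.card F = q → Module.finrank (RatFunc F) K = d →
        ∀ h : ℝ, 1 ≤ h → ∀ A B : Finset K,
          (∀ a ∈ A, height F a ≤ h) → (∀ b ∈ B, height F b ≤ h) →
          (∃ a ∈ A, a ≠ 0) → (∃ b ∈ B, b ≠ 0) →
          Real.exp (-(C * (h / Real.log (h + 2)))) * (A.card * B.card) < (A * B).card) ∧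
    ∀ ν : ℕ, ∃ C : ℝ, 0 < C ∧
      ∀ (F : Type u) [Field F] [Finite F] (K : Type v) [Field K] [DecidableEq K]
        [Algebra (RatFunc F) K] [FiniteDimensional (RatFunc F) K],
        Nat.card F = q → Module.finrank (RatFunc F) K = d →
        ∀ h : ℝ, 1 ≤ h → ∀ A : Finset K, A.Nonempty → (∀ a ∈ A, height F a ≤ h) →
          Real.exp (-(C * (h / Real.log (h + 2)))) * (A.card : ℝ) ^ ν < (A ^ ν).card := by
  have hgauge {h : ℝ} (hh : 1 ≤ h) : 0 < h / Real.log (h + 2) :=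
    one_half_pos.trans_le (one_half_le_div_log_add_two hh)
  refine ⟨?_, fun ν => ?_⟩
  · obtain ⟨C, hC, hmul⟩ := exists_card_mul_card_le.{u, v} q d
    refine ⟨C + 1, by positivity, fun F _ _ K _ _ _ _ hq hd h hh A B hA hB hA0 hB0 => ?_⟩
    have hApos : (0 : ℝ) < A.card := mod_cast Finset.card_pos.2 (hA0.imp fun _ => And.left)
    have hBpos : (0 : ℝ) < B.card := mod_cast Finset.card_pos.2 (hB0.imp fun _ => And.left)
    exact exp_neg_mul_lt_of_le_exp_mul (mul_pos hApos hBpos) (hgauge hh)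
      (hmul F K hq hd h hh A B hA hB hA0 hB0)
  · obtain ⟨C, hC, hpow⟩ := exists_card_pow_le.{u, v} q d ν
    refine ⟨C + 1, by positivity, fun F _ _ K _ _ _ _ hq hd h hh A hAne hA => ?_⟩
    have hApos : (0 : ℝ) < A.card := mod_cast Finset.card_pos.2 hAne
    exact exp_neg_mul_lt_of_le_exp_mul (pow_pos hApos ν) (hgauge hh)
      (hpow F K hq hd h hh A hAne hA)

open FunctionFieldHeight in
theorem mainTheorem3 (q d : ℕ) :
    (∃ C : ℝ, 0 < C ∧
      ∀ (F : Type u) [Field F] [Fintype F] (K : Type v) [Field K] [DecidableEq K]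
        [Algebra (RatFunc F) K] [FiniteDimensional (RatFunc F) K],
        Fintype.card F = q → Module.finrank (RatFunc F) K = d →
        ∀ (h : ℝ), 1 < h → ∀ A B : Finset K,
          (∀ a ∈ A, (FunctionFieldHeight.height F a : ℝ) ≤ h) →
          (∀ b ∈ B, (FunctionFieldHeight.height F b : ℝ) ≤ h) →
          (∃ a ∈ A, a ≠ 0) → (∃ b ∈ B, b ≠ 0) →
          ((A * B).card : ℝ) >
            Real.exp (-(C * (h / Real.sqrt (Real.log h)))) * ((A.card : ℝ) * (B.card : ℝ))) ∧
    (∀ ν : ℕ, 0 < ν → ∃ C : ℝ, 0 < C ∧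
      ∀ (F : Type u) [Field F] [Fintype F] (K : Type v) [Field K] [DecidableEq K]
        [Algebra (RatFunc F) K] [FiniteDimensional (RatFunc F) K],
        Fintype.card F = q → Module.finrank (RatFunc F) K = d →
        ∀ (h : ℝ), 1 < h → ∀ A : Finset K, A.Nonempty →
          (∀ a ∈ A, (FunctionFieldHeight.height F a : ℝ) ≤ h) →
          ((A ^ ν).card : ℝ) >
            Real.exp (-(C * (h / Real.sqrt (Real.log h)))) * (A.card : ℝ) ^ ν) := by
  obtain ⟨⟨C, hC, hmul⟩, hpow⟩ := mainTheorem3_general.{u, v} q d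
  refine ⟨⟨C, hC, fun F _ _ K _ _ _ _ hq hd h hh A B hA hB hA0 hB0 => ?_⟩, fun ν _ => ?_⟩
  · exact (exp_neg_mul_div_sqrt_log_mul_le hC hh (by positivity)).trans_lt
      (hmul F K (Nat.card_eq_fintype_card.trans hq) hd h hh.le A B hA hB hA0 hB0)
  · obtain ⟨C, hC, hpow⟩ := hpow ν
    refine ⟨C, hC, fun F _ _ K _ _ _ _ hq hd h hh A hAne hA => ?_⟩
    exact (exp_neg_mul_div_sqrt_log_mul_le hC hh (by positivity)).trans_lt
      (hpow F K (Nat.card_eq_fintype_card.trans hq) hd h hh.le A hAne hA)
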